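/- **Setting.** There are finitely many fires $g\in\mathcal G$ (at least one), finitely many crews $j\in\mathcal J$, $J=|\mathcal J|$, and periods $\mathcal T=\{1,\dots,T\}$ followed by a sink period $T+1$. *Crew networks.* Crew $j$ has a finite location set $\mathcal L_j$ containing its base $b_j$, its initial location $\ell_j^1$ and the (pairwise distinct) locations of the fires $\mathcal G_j$ in its jurisdiction. Its network has the nodes $(\ell,t,r)$, $\ell\in\mathcal L_j$, $2\le t\le T+1$, $r\in\{0,1\}$ (rested or not), and the start node $(\ell_j^1,1,0)$. Arcs between nodes are: traveling arcs $(\ell_1,t,r)\to(\ell_2,t+k,r)$, $\ell_1\ne\ell_2$, where $k=\min\{\tau\in\mathcal T:\tau\ge tt(\ell_1,\ell_2)\}$ for the travel time $tt$; working arcs $(g,t,r)\to(g,t+1,r)$, $g\in\mathcal G_j$; resting arcs $(b_j,t,0)\to(b_j,t',1)$ with $t'>t$ and $t'-t\ge\gamma$, and $(b_j,t,r)\to(b_j,t+1,r)$. Traveling and working arcs leaving a node $(\ell,t,0)$ with $t>\min(\varphi+r_j^0,T)$ are removed, where $r^0_j$ is the time of the last completed rest and $\varphi$ the allowed time between rests.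 The set $\mathcal P_j$ of routes consists of the paths from the start node to a node of period $T+1$; $c_p$ is the sum of the arc costs of $p$, and $A_{pgt}=1$ if $g\in\mathcal G_j$ and $p$ uses an arc leaving $(g,t,0)$ or $(g,t,1)$, and $A_{pgt}=0$ otherwise. *Fire networks.* Fire $g$ has a partially ordered state space with a finite discretization $\mathcal S_g$, an initial state $s_g^1$, transition functions $f_{gt}(s,x)$, and cost functions $d_{gt}(s,x)$, $h_g(s)$. Its network has the nodes $(s,t)$, $s\in\mathcal S_g$, $2\le t\le T+1$, and the start node $(s_g^1,1)$. There is an arc $a=(s,t)\to(s',t+1)$ if for some $x\in\{0,\dots,J\}$ the least element of $\{\sigma\in\mathcal S_g:\sigma\ge f_{gt}(s,x)\}$ exists and equals $s'$; $x_a$ is the smallest such $x$, and the arc costs $d_{gt}(s,x_a)$, plus $h_g(s')$ if $t=T$. The set $\mathcal Q_g$ of plans consists of the paths from the start node to a node of period $T+1$; $d_q$ is the sum of the arc costs of $q$, and $B_{qt}$ is $x_a$ for the arc $a$ of $q$ that leaves period $t$. All costs $c_p$ and $d_q$ are assumed to be nonnegative; the transition functions are arbitrary. *Problem (SP).* Minimize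 $\sum_j\sum_{p\in\mathcal P_j}c_pz_p+\sum_g\sum_{q\in\mathcal Q_g}d_qy_q$ subject to $\sum_{q\in\mathcal Q_g}y_q=1$ for all $g$; $\sum_{p\in\mathcal P_j}z_p=1$ for all $j$; $\sum_j\sum_{p\in\mathcal P_j}A_{pgt}z_p-\sum_{q\in\mathcal Q_g}B_{qt}y_q\ge0$ for all $g,t$; and $y_q,z_p\in\{0,1\}$. **Cuts.** For $t\in\mathcal T$, $\mathcal G_u\subseteq\mathcal G$, $\mathcal J_u\subseteq\mathcal J$, $\delta=(\delta_{gd})_{g\in\mathcal G_u,\,0\le d\le J}$ and $K\in\mathbb R$, the associated cut is $$\sum_{g\in\mathcal G_u}\sum_{q\in\mathcal Q_g}\sum_{d=0}^J\mathbf 1[B_{qt}=d]\,\delta_{gd}\,y_q+\sum_{j\in\mathcal J_u}\sum_{p\in\mathcal P_j}\mathbf 1\Big[\sum_{g\in\mathcal G_u}A_{pgt}=0\Big]z_p\le|\mathcal J_u|+K.$$ It is a *GUB cover cut* if $\delta_{gd}=\mathbf 1[d\ge D_g]$ and $K=|\mathcal G_u|-1$ for some $D\in\{0,\dots,J\}^{\mathcal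 G_u}$ with $\sum_{g\in\mathcal G_u}D_g+|\mathcal J_u|>J$. It is an *augmented GUB cut* if $(\delta,K)$ is an extreme point of the feasible region of the cut generating linear program, i.e. of the set of $(\delta,K)$ with $0\le\delta\le1$ and $\sum_{(g,d)\in H}\delta_{gd}\le K$ for every $H\subseteq\mathcal G_u\times\{0,\dots,J\}$ with at most one pair for each fire and $\sum_{(g,d)\in H}d\le J-|\mathcal J_u|$. **Algorithm (two-sided branch-and-price-and-cut), with constants $M,M'$.** A node of the branching tree is a list of branching decisions, together with initial sets of columns and cuts. At a node, only columns complying with its decisions are used. The algorithm keeps a list of unexplored nodes and an incumbent, whose cost is UB ($\infty$ if there is none). It starts at the root (no decisions, columns or cuts) and repeats Steps 1–4. 1. (a) *Column generation.* Set $c=\infty$ and the duals $\sigma_g=M'$ (fires), $\pi_j=0$ (crews), $\rho_{gt}=M$ (linking), $\alpha_u=0$ (cuts). Repeat: for every fire and every crew, find a complying plan, resp. route, of least reduced cost, where the reduced costs are $$d_q+\sum_tB_{qt}\rho_{gt}+\sum_u\mathrm{coef}_u(q)\alpha_u-\sigma_g,\qquad c_p-\sum_{g,t}A_{pgt}\rho_{gt}+\sum_u\mathrm{coef}_u(p)\alpha_u-\pi_j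 .$$ If none of these is negative, stop (the node is infeasible if $c=\infty$). Otherwise add those of negative reduced cost to the columns, and solve the linear relaxation of (SP) restricted to the generated columns, with the current cuts. If it is feasible, store an optimal solution $(y,z)$, its cost $c$ and an optimal dual solution. If it is infeasible, set $(\sigma,\pi,\rho,\alpha)=M'\cdot r$ for a dual ray $r$ of positive dual objective that is an extreme point of $\{r'\in\mathcal C:\|r'\|_1\le1\}$, where $\mathcal C$ is the recession cone of the dual; when $\mathcal C$ is pointed, every extreme ray of positive dual objective, scaled to $\|r\|_1=1$, is of this kind. (b) *Cuts.* If a solution $(y,z)$ was found, GUB cover cuts and augmented GUB cuts violated by it may be added; if any is added, return to (a), keeping columns and cuts. 2. *Pruning and branching.* If $c<\mathrm{UB}$ and all variances $$v(g,t)=\sum_qB_{qt}^2y_q-\Big(\sum_qB_{qt}y_q\Big)^2,\qquad w(j,g,t)=\sum_pA_{pgt}^2z_p-\Big(\sum_pA_{pgt}z_p\Big)^2$$ vanish (in particular if $(y,z)$ is integer), the incumbent becomes an integer vector selecting, for each fire and each crew, one column in the support of $(y,z)$; go to Step 4. If $c\ge\mathrm{UB}$, prune the node. Otherwise choose positive weights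 $\omega_{gt}$ (for instance $\omega=1$, or the perturbed dual prices $\rho$), select a largest variance among all $v(g,t)$ and $w(j,g,t)$ computed with $B_{qt}\omega_{gt}$, $A_{pgt}\omega_{gt}$ in place of $B_{qt}$, $A_{pgt}$, and create two nodes by adding to the decisions of the current node one side each of the disjunction $$\sum_q\mathbf 1[B_{qt}>d]\,y_q=0\ \lor\ \sum_q\mathbf 1[B_{qt}>d]\,y_q=1,\quad d=\Big\lfloor\sum_qB_{qt}y_q\Big\rfloor,\qquad\text{resp.}\qquad\sum_p\mathbf 1[A_{pgt}=1]z_p=0\ \lor\ \sum_p\mathbf 1[A_{pgt}=1]z_p=1 .$$ The new nodes inherit the complying columns and the cuts with $\alpha_u>0$. 3. *Heuristic (optional).* The incumbent may be replaced by any feasible solution of (SP) of cost less than UB. 4. If there is no unexplored node, stop and return the incumbent. Otherwise, remove a node from the list and process it from Step 1. All choices that are left open (optimal solutions, rays, cuts to add, weights, ties, order of the nodes, heuristic solutions) are arbitrary. **Theorem.** For every $M\ge0$ there is $M_0$ such that for every $M'\ge M_0$, whatever choices are made, the algorithm can always carry out its next step until it returns, it returns after finitely many iterations (counting also those of column generation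 and of cut generation), and it returns an optimal solution of (SP) if (SP) is feasible, and no solution if (SP) is infeasible. -/

import Mathlib

universe u

noncomputable section

namespace Wildfire

open Classical

/-! ### Paths in directed networks -/

/-- A directed path, given by the list of its nodes, that starts in `start` and ends in a node
satisfying `final`. -/
structure NetPath {V : Type u} (arc : V → V → Prop) (start : V) (final : V → Prop) where
  nodes : List V
  head_eq : nodes.head? = some start
  chain : nodes.IsChain arc
  last_eq : ∃ v, nodes.getLast? = some v ∧ final v

/-- The set of arcs traversed by a path. -/
def NetPath.arcs {V : Type u} {arc : V → V → Prop} {start : V} {final : V → Prop}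
    (p : NetPath arc start final) : Finset (V × V) :=
  (p.nodes.zip p.nodes.tail).toFinset

/-- A network with finitely many nodes, all of whose arcs go strictly forward in time, has finitely
many paths. -/
theorem NetPath.finite {V : Type u} {arc : V → V → Prop} {start : V} {final : V → Prop}
    (time : V → ℕ) (N : Set V) (hN : N.Finite) (hs : start ∈ N)
    (ht : ∀ a b, arc a b → time a < time b) (hb : ∀ a b, arc a b → b ∈ N) :
    Finite (NetPath arc start final) := by
  have key : ∀ (l : List V) (s : V), l.head? = some s → s ∈ N → l.IsChain arc →
      ∀ x ∈ l, x ∈ N := by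
    intro l
    induction l with
    | nil => intro s h; simp at h
    | cons a l ih =>
      intro s h hsN hc x hx
      simp only [List.head?_cons, Option.some.injEq] at h
      subst h
      rcases List.mem_cons.1 hx with rfl | hx
      · exact hsN
      · cases l with
        | nil => simp at hx
        | cons b l =>
          rw [List.isChain_cons_cons] at hc
          exact ih b rfl (hb _ _ hc.1) hc.2 x hx
  have hmem : ∀ p : NetPath arc start final, ∀ x ∈ p.nodes, x ∈ N := fun p =>
    key p.nodes start p.head_eq hs p.chain
  have hnd : ∀ p : NetPath arc start final, p.nodes.Nodup := by
    intro p
    have h1 : p.nodes.IsChain (fun a b => time a < time b) := p.chain.imp (fun a b h => ht a b h)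
    have : IsTrans V (fun a b => time a < time b) := ⟨fun _ _ _ h k => lt_trans h k⟩
    have h2 := h1.pairwise
    exact h2.imp (fun {a b} h e => by subst e; exact lt_irrefl _ h)
  have : Finite N := hN.to_subtype
  have : Fintype N := Fintype.ofFinite N
  let F : NetPath arc start final → {l : List N // l.Nodup} := fun p =>
    ⟨p.nodes.attachWith (· ∈ N) (hmem p), by
      have := hnd p
      rw [← List.attachWith_map_subtype_val (hmem p)] at this
      exact List.Nodup.of_map _ this⟩
  refine Finite.of_injective F ?_
  intro p q h
  have h' : p.nodes.attachWith (· ∈ N) (hmem p) = q.nodes.attachWith (· ∈ N) (hmem q) :=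
    congrArg Subtype.val h
  have h'' : p.nodes = q.nodes := by
    rw [← List.attachWith_map_subtype_val (hmem p), h', List.attachWith_map_subtype_val]
  cases p; cases q; simp only at h''; subst h''; rfl

/-! ### The two-sided set partitioning problem -/

/-- The data of a two-sided set partitioning problem: `Plan g` is the set of suppression plans of
fire `g`, `Route j` the set of routes of crew `j`, `A j p g t` the assignment of route `p` to fire
`g` in period `t`, and `B g q t` the crew demand of plan `q` in period `t`. -/
structure SetPartitioning where
  Fire : Type u
  Crew : Type u
  T : ℕ
  Plan : Fire → Type u
  Route : Crew → Type u
  fireFintype : Fintype Fire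
  crewFintype : Fintype Crew
  planFintype : ∀ g, Fintype (Plan g)
  routeFintype : ∀ j, Fintype (Route j)
  planCost : ∀ g, Plan g → ℝ
  routeCost : ∀ j, Route j → ℝ
  A : ∀ j, Route j → Fire → {t : ℕ // t ∈ Finset.Icc 1 T} → ℕ
  B : ∀ g, Plan g → {t : ℕ // t ∈ Finset.Icc 1 T} → ℕ

namespace SetPartitioning

attribute [instance] fireFintype crewFintype planFintype routeFintype

/-- The periods `1, …, T`. -/
abbrev Time (S : SetPartitioning.{u}) : Type := {t : ℕ // t ∈ Finset.Icc 1 S.T}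

/-- The number of crews. -/
abbrev numCrews (S : SetPartitioning.{u}) : ℕ := Fintype.card S.Crew

/-- A vector `(y, z)` of (possibly fractional) values of the path variables. -/
@[ext]
structure Sol (S : SetPartitioning.{u}) where
  y : ∀ g, S.Plan g → ℝ
  z : ∀ j, S.Route j → ℝ

variable (S : SetPartitioning.{u})

/-- The objective. -/
def cost (x : S.Sol) : ℝ :=
  (∑ j, ∑ p, S.routeCost j p * x.z j p) + ∑ g, ∑ q, S.planCost g q * x.y g q

/-- Feasibility for the linear relaxation: set partitioning for each fire and each crew, linking,
nonnegativity. -/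
structure IsLPFeasible (x : S.Sol) : Prop where
  plan : ∀ g, ∑ q, x.y g q = 1
  route : ∀ j, ∑ p, x.z j p = 1
  link : ∀ g t, 0 ≤ (∑ j, ∑ p, (S.A j p g t : ℝ) * x.z j p) - ∑ q, (S.B g q t : ℝ) * x.y g q
  z_nonneg : ∀ j p, 0 ≤ x.z j p
  y_nonneg : ∀ g q, 0 ≤ x.y g q

/-- Feasibility for the two-sided set partitioning problem. -/
structure IsFeasible (x : S.Sol) : Prop where
  plan : ∀ g, ∑ q, x.y g q = 1
  route : ∀ j, ∑ p, x.z j p = 1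
  link : ∀ g t, 0 ≤ (∑ j, ∑ p, (S.A j p g t : ℝ) * x.z j p) - ∑ q, (S.B g q t : ℝ) * x.y g q
  z_binary : ∀ j p, x.z j p = 0 ∨ x.z j p = 1
  y_binary : ∀ g q, x.y g q = 0 ∨ x.y g q = 1

/-- Optimality for the two-sided set partitioning problem. -/
def IsOptimal (x : S.Sol) : Prop :=
  S.IsFeasible x ∧ ∀ x', S.IsFeasible x' → S.cost x ≤ S.cost x'

/-- The cost of a solution, with `∞` for "no solution". -/
def costOrTop : Option S.Sol → WithTop ℝ
  | none => ⊤
  | some x => (S.cost x : WithTop ℝ)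

/-! ### Cutting planes -/

/-- A cut
`∑_{g ∈ fires} ∑_q ∑_d 1[B_{qt} = d] δ_{gd} y_q + ∑_{j ∈ crews} ∑_p 1[∑_{g ∈ fires} A_{pgt} = 0] z_p
  ≤ |crews| + K`. -/
structure Cut where
  t : S.Time
  fires : Finset S.Fire
  crews : Finset S.Crew
  δ : S.Fire → Fin (S.numCrews + 1) → ℝ
  K : ℝ

variable {S}

/-- Coefficient of a plan in a cut. -/
def Cut.planCoef (u : S.Cut) (g : S.Fire) (q : S.Plan g) : ℝ :=
  if g ∈ u.fires then ∑ d : Fin (S.numCrews + 1), if S.B g q u.t = d then u.δ g d else 0 else 0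

/-- Coefficient of a route in a cut. -/
def Cut.routeCoef (u : S.Cut) (j : S.Crew) (p : S.Route j) : ℝ :=
  if j ∈ u.crews ∧ ∑ g ∈ u.fires, S.A j p g u.t = 0 then 1 else 0

/-- Left-hand side of a cut. -/
def Cut.lhs (u : S.Cut) (x : S.Sol) : ℝ :=
  (∑ g, ∑ q, u.planCoef g q * x.y g q) + ∑ j, ∑ p, u.routeCoef j p * x.z j p

/-- Right-hand side of a cut. -/
def Cut.rhs (u : S.Cut) : ℝ := (u.crews.card : ℝ) + u.K

variable (S)

/-- Sets of target demands, at most one per fire of `Gu`, that can be met without the crews of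
`Ju`. -/
def demandSets (Gu : Finset S.Fire) (Ju : Finset S.Crew) :
    Set (Finset (S.Fire × Fin (S.numCrews + 1))) :=
  {H | (∀ a ∈ H, a.1 ∈ Gu) ∧ (∑ a ∈ H, (a.2 : ℕ)) + Ju.card ≤ S.numCrews ∧
    ∀ g ∈ Gu, (H.filter fun a => a.1 = g).card ≤ 1}

/-- The feasible region, in `(δ, K)`, of the cut generating linear program. -/
def cglp (Gu : Finset S.Fire) (Ju : Finset S.Crew) :
    Set ((S.Fire → Fin (S.numCrews + 1) → ℝ) × ℝ) :=
  {w | (∀ g ∈ Gu, ∀ d, 0 ≤ w.1 g d ∧ w.1 g d ≤ 1) ∧ (∀ g ∉ Gu, ∀ d, w.1 g d = 0) ∧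
    ∀ H ∈ S.demandSets Gu Ju, ∑ a ∈ H, w.1 a.1 a.2 ≤ w.2}

/-- The GUB cover cuts: targets `D_g ∈ {0, …, J}` with `∑_{g ∈ fires} D_g + |crews| > J`, weights
`δ_{gd} = 1[d ≥ D_g]` and `K = |fires| - 1`. -/
def IsGUBCover (u : S.Cut) : Prop :=
  ∃ D : S.Fire → Fin (S.numCrews + 1),
    S.numCrews < (∑ g ∈ u.fires, (D g : ℕ)) + u.crews.card ∧
    u.δ = (fun g d => if g ∈ u.fires ∧ D g ≤ d then 1 else 0) ∧
    u.K = (u.fires.card : ℝ) - 1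

/-- The augmented GUB cuts produced by the cut generating linear program, whose solver returns basic
solutions, that is, extreme points of the feasible region. -/
def IsAugmentedGUB (u : S.Cut) : Prop :=
  (u.δ, u.K) ∈ Set.extremePoints ℝ (S.cglp u.fires u.crews)

/-! ### Branching -/

/-- One side of a branching disjunction. `fire g t d up` stands for
`∑_q 1[B_{qt} > d] y_q = 1` if `up`, and `= 0` otherwise; `crew j g t up` stands for
`∑_p 1[A_{pgt} = 1] z_p = 1` if `up`, and `= 0` otherwise. -/
inductive Branch
  | fire (g : S.Fire) (t : S.Time) (d : ℕ) (up : Bool)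
  | crew (j : S.Crew) (g : S.Fire) (t : S.Time) (up : Bool)

variable {S}

/-- The plans that comply with a branching decision. -/
def Branch.AllowsPlan (g : S.Fire) (q : S.Plan g) : S.Branch → Prop
  | .fire g' t d up => g' = g → (d < S.B g q t ↔ up = true)
  | .crew _ _ _ _ => True

/-- The routes that comply with a branching decision. -/
def Branch.AllowsRoute (j : S.Crew) (p : S.Route j) : S.Branch → Prop
  | .fire _ _ _ _ => True
  | .crew j' g t up => j' = j → (S.A j p g t = 1 ↔ up = true)

variable (S)

/-- The plans that comply with all branching decisions of a node. -/
def allowedPlans (b : List S.Branch) (g : S.Fire) : Finset (S.Plan g) :=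
  Finset.univ.filter fun q => ∀ a ∈ b, a.AllowsPlan g q

/-- The routes that comply with all branching decisions of a node. -/
def allowedRoutes (b : List S.Branch) (j : S.Crew) : Finset (S.Route j) :=
  Finset.univ.filter fun p => ∀ a ∈ b, a.AllowsRoute j p

/-! ### Restricted master problem -/

/-- The columns that have been generated. -/
structure Columns where
  Q : ∀ g, Finset (S.Plan g)
  P : ∀ j, Finset (S.Route j)

/-- Feasibility for the restricted master problem over the columns `C` with the cuts `U`. -/
structure IsRMPFeasible (C : S.Columns) (U : Finset S.Cut) (x : S.Sol) : Prop where
  lp : S.IsLPFeasible x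
  y_supp : ∀ g, ∀ q ∉ C.Q g, x.y g q = 0
  z_supp : ∀ j, ∀ p ∉ C.P j, x.z j p = 0
  cuts : ∀ u ∈ U, u.lhs x ≤ u.rhs

/-- Optimality for the restricted master problem. -/
def IsRMPOptimal (C : S.Columns) (U : Finset S.Cut) (x : S.Sol) : Prop :=
  S.IsRMPFeasible C U x ∧ ∀ x', S.IsRMPFeasible C U x' → S.cost x ≤ S.cost x'

/-- Dual vectors `(σ, π, ρ, α)`: duals of the fire partitioning, crew partitioning and linking
constraints, and of the cuts. -/
abbrev Dual : Type u :=
  (S.Fire → ℝ) × (S.Crew → ℝ) × (S.Fire → S.Time → ℝ) × (S.Cut → ℝ)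

variable {S}

/-- The dual value `σ_g - ∑_t B_{qt} ρ_{gt} - ∑_u coef_u(q) α_u` of a plan. -/
def planValue (U : Finset S.Cut) (D : S.Dual) (g : S.Fire) (q : S.Plan g) : ℝ :=
  D.1 g - (∑ t, (S.B g q t : ℝ) * D.2.2.1 g t) - ∑ u ∈ U, u.planCoef g q * D.2.2.2 u

/-- The dual value `π_j + ∑_{g,t} A_{pgt} ρ_{gt} - ∑_u coef_u(p) α_u` of a route. -/
def routeValue (U : Finset S.Cut) (D : S.Dual) (j : S.Crew) (p : S.Route j) : ℝ :=
  D.2.1 j + (∑ g, ∑ t, (S.A j p g t : ℝ) * D.2.2.1 g t) - ∑ u ∈ U, u.routeCoef j p * D.2.2.2 u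

/-- The reduced cost of a plan. -/
def planReducedCost (U : Finset S.Cut) (D : S.Dual) (g : S.Fire) (q : S.Plan g) : ℝ :=
  S.planCost g q - planValue U D g q

/-- The reduced cost of a route. -/
def routeReducedCost (U : Finset S.Cut) (D : S.Dual) (j : S.Crew) (p : S.Route j) : ℝ :=
  S.routeCost j p - routeValue U D j p

/-- The dual objective. -/
def dualObj (U : Finset S.Cut) (D : S.Dual) : ℝ :=
  (∑ g, D.1 g) + (∑ j, D.2.1 j) - ∑ u ∈ U, u.rhs * D.2.2.2 u

/-- The 1-norm of a dual vector. -/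
def dualNorm (U : Finset S.Cut) (D : S.Dual) : ℝ :=
  (∑ g, |D.1 g|) + (∑ j, |D.2.1 j|) + (∑ g, ∑ t, |D.2.2.1 g t|) + ∑ u ∈ U, |D.2.2.2 u|

/-- Sign constraints on the dual variables of the inequality constraints. -/
structure IsDualSigned (U : Finset S.Cut) (D : S.Dual) : Prop where
  ρ_nonneg : ∀ g t, 0 ≤ D.2.2.1 g t
  α_nonneg : ∀ u ∈ U, 0 ≤ D.2.2.2 u
  α_supp : ∀ u ∉ U, D.2.2.2 u = 0

/-- Feasibility for the dual of the restricted master problem. -/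
structure IsDualFeasible (C : S.Columns) (U : Finset S.Cut) (D : S.Dual) : Prop where
  signed : IsDualSigned U D
  plan : ∀ g, ∀ q ∈ C.Q g, planValue U D g q ≤ S.planCost g q
  route : ∀ j, ∀ p ∈ C.P j, routeValue U D j p ≤ S.routeCost j p

/-- Optimality for the dual of the restricted master problem. -/
def IsDualOptimal (C : S.Columns) (U : Finset S.Cut) (D : S.Dual) : Prop :=
  IsDualFeasible C U D ∧ ∀ D', IsDualFeasible C U D' → dualObj U D' ≤ dualObj U D

/-- The recession cone of the dual of the restricted master problem. -/
def dualCone (C : S.Columns) (U : Finset S.Cut) : Set S.Dual :=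
  {D | IsDualSigned U D ∧ (∀ g, ∀ q ∈ C.Q g, planValue U D g q ≤ 0) ∧
    ∀ j, ∀ p ∈ C.P j, routeValue U D j p ≤ 0}

/-- A normalized dual extreme ray of positive dual objective, which certifies that the restricted
master problem is infeasible. It is an extreme point of the part of the dual cone inside the unit
ball of the 1-norm; if the cone is pointed, every extreme ray of it, scaled to norm 1, is one. (The
cone contains lines, and so has no extreme ray in the strict sense, as long as some fire or crew has
no column.) -/
def IsNormalizedExtremeRay (C : S.Columns) (U : Finset S.Cut) (D : S.Dual) : Prop :=
  D ∈ Set.extremePoints ℝ {D' | D' ∈ dualCone C U ∧ dualNorm U D' ≤ 1} ∧ 0 < dualObj U D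

/-! ### Maximum-variance branching -/

/-- The mean demand `∑_q B_{qt} y_q` of fire `g` in period `t`. -/
def meanDemand (x : S.Sol) (g : S.Fire) (t : S.Time) : ℝ := ∑ q, (S.B g q t : ℝ) * x.y g q

/-- The variance `v(g, t)`, with weights `ω`. -/
def fireVar (ω : S.Fire → S.Time → ℝ) (x : S.Sol) (g : S.Fire) (t : S.Time) : ℝ :=
  (∑ q, ((S.B g q t : ℝ) * ω g t) ^ 2 * x.y g q) - (∑ q, (S.B g q t : ℝ) * ω g t * x.y g q) ^ 2

/-- The variance `w(j, g, t)`, with weights `ω`. -/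
def crewVar (ω : S.Fire → S.Time → ℝ) (x : S.Sol) (j : S.Crew) (g : S.Fire) (t : S.Time) : ℝ :=
  (∑ p, ((S.A j p g t : ℝ) * ω g t) ^ 2 * x.z j p) -
    (∑ p, (S.A j p g t : ℝ) * ω g t * x.z j p) ^ 2

/-- All fire demands and all crew assignments have variance zero. -/
def ZeroVariance (x : S.Sol) : Prop :=
  (∀ g t, fireVar (fun _ _ => 1) x g t = 0) ∧ ∀ j g t, crewVar (fun _ _ => 1) x j g t = 0

/-- `m` is the largest variance, over all fire demands and all crew assignments. -/
def IsMaxVariance (ω : S.Fire → S.Time → ℝ) (x : S.Sol) (m : ℝ) : Prop :=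
  (∀ g t, fireVar ω x g t ≤ m) ∧ ∀ j g t, crewVar ω x j g t ≤ m

/-- The disjunctions that maximum-variance branching with weights `ω` may select at `x`, as functions
of the side `up`. A demand is split at its rounded-down mean. -/
inductive MaxVarianceBranching (ω : S.Fire → S.Time → ℝ) (x : S.Sol) : (Bool → S.Branch) → Prop
  | fire (g : S.Fire) (t : S.Time) (h : IsMaxVariance ω x (fireVar ω x g t)) :
      MaxVarianceBranching ω x (fun up => .fire g t ⌊meanDemand x g t⌋₊ up)
  | crew (j : S.Crew) (g : S.Fire) (t : S.Time) (h : IsMaxVariance ω x (crewVar ω x j g t)) :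
      MaxVarianceBranching ω x (fun up => .crew j g t up)

/-- `x'` is an integer vector that selects, for each fire and each crew, one column in the support of
`x`. If `x` is itself integer then `x' = x`. -/
def IsIntegerSelection (x x' : S.Sol) : Prop :=
  (∀ g, ∃ q, 0 < x.y g q ∧ x'.y g = fun r => if r = q then 1 else 0) ∧
    ∀ j, ∃ p, 0 < x.z j p ∧ x'.z j = fun r => if r = p then 1 else 0

variable (S)

/-! ### The branch-and-price-and-cut algorithm -/

/-- A node of the branching tree: its branching decisions, and the columns and cuts with which it is
initialized. -/
structure TreeNode where
  branch : List S.Branch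
  cols : S.Columns
  cuts : Finset S.Cut

/-- The working data while a node is processed: `sol` is the last solution `(y, z)` of a restricted
master problem, with `none` for `c = ∞`. -/
structure Work where
  branch : List S.Branch
  cols : S.Columns
  cuts : Finset S.Cut
  sol : Option S.Sol
  dual : S.Dual

/-- The point of the algorithm that is executed next. -/
inductive Phase
  /-- an iteration of column generation -/
  | columnGeneration (w : S.Work)
  /-- separation of cuts, after column generation has stopped -/
  | separation (w : S.Work)
  /-- pruning or branching, after both have stopped -/
  | evaluation (w : S.Work)
  /-- the optional heuristic -/
  | heuristic
  /-- choice of the next node, or termination -/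
  | selection
  /-- the algorithm has returned the incumbent -/
  | returned

/-- A state of the algorithm: the unexplored nodes, the best integer solution found (`none` if none;
its cost is the upper bound), and the phase. -/
structure State where
  unexplored : Multiset S.TreeNode
  incumbent : Option S.Sol
  phase : S.Phase

/-- Removes the columns that violate a branching decision. -/
def Columns.restrict {S : SetPartitioning.{u}} (C : S.Columns) (b : List S.Branch) : S.Columns where
  Q g := C.Q g ∩ S.allowedPlans b g
  P j := C.P j ∩ S.allowedRoutes b j

/-- Initialization of column generation: `c = ∞`, `σ = M'`, `π = 0`, `ρ = M`, and dual price zero for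
all cuts. -/
def initWork (M M' : ℝ) (b : List S.Branch) (C : S.Columns) (U : Finset S.Cut) : S.Work where
  branch := b
  cols := C
  cuts := U
  sol := none
  dual := (fun _ => M', fun _ => 0, fun _ _ => M, fun _ => 0)

/-- The initial state: the root node, without columns, cuts and branching decisions. -/
def initState (M M' : ℝ) : S.State where
  unexplored := 0
  incumbent := none
  phase := .columnGeneration (S.initWork M M' [] ⟨fun _ => ∅, fun _ => ∅⟩ ∅)

variable {S}

/-- `q` solves the pricing problems of the fires at the node with data `w` (`none` if the fire has no
plan there). -/
def SolvesFirePricing (w : S.Work) (q : ∀ g, Option (S.Plan g)) : Prop :=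
  ∀ g, (q g = none ∧ S.allowedPlans w.branch g = ∅) ∨
    ∃ r ∈ S.allowedPlans w.branch g, q g = some r ∧ ∀ r' ∈ S.allowedPlans w.branch g,
      planReducedCost w.cuts w.dual g r ≤ planReducedCost w.cuts w.dual g r'

/-- `p` solves the pricing problems of the crews at the node with data `w` (`none` if the crew has no
route there). -/
def SolvesCrewPricing (w : S.Work) (p : ∀ j, Option (S.Route j)) : Prop :=
  ∀ j, (p j = none ∧ S.allowedRoutes w.branch j = ∅) ∨
    ∃ r ∈ S.allowedRoutes w.branch j, p j = some r ∧ ∀ r' ∈ S.allowedRoutes w.branch j,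
      routeReducedCost w.cuts w.dual j r ≤ routeReducedCost w.cuts w.dual j r'

/-- All pricing problems return solutions with nonnegative reduced cost. -/
def NonnegReducedCosts (w : S.Work) (q : ∀ g, Option (S.Plan g)) (p : ∀ j, Option (S.Route j)) :
    Prop :=
  (∀ g, ∀ r ∈ q g, 0 ≤ planReducedCost w.cuts w.dual g r) ∧
    ∀ j, ∀ r ∈ p j, 0 ≤ routeReducedCost w.cuts w.dual j r

/-- Adds the priced columns with negative reduced cost. -/
def expand (w : S.Work) (q : ∀ g, Option (S.Plan g)) (p : ∀ j, Option (S.Route j)) : S.Columns where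
  Q g := w.cols.Q g ∪ (q g).toFinset.filter fun r => planReducedCost w.cuts w.dual g r < 0
  P j := w.cols.P j ∪ (p j).toFinset.filter fun r => routeReducedCost w.cuts w.dual j r < 0

/-- `w'` results from `w` by solving the restricted master problem of `w`: either an optimal primal
and an optimal dual solution are stored, or the problem is infeasible and the duals are set to `M'`
times a normalized dual extreme ray. -/
inductive SolvesMaster (M' : ℝ) (w : S.Work) : S.Work → Prop
  | optimal (x : S.Sol) (D : S.Dual) (hx : S.IsRMPOptimal w.cols w.cuts x)
      (hD : IsDualOptimal w.cols w.cuts D) :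
      SolvesMaster M' w { w with sol := some x, dual := D }
  | infeasible (D : S.Dual) (hx : ∀ x, ¬ S.IsRMPFeasible w.cols w.cuts x)
      (hD : IsNormalizedExtremeRay w.cols w.cuts D) :
      SolvesMaster M' w { w with dual := M' • D }

/-- The child of the node with data `w` that is obtained by adding the branching decision `a`. It
inherits the columns that comply with `a` and the cuts with positive dual price. -/
def child (w : S.Work) (a : S.Branch) : S.TreeNode where
  branch := a :: w.branch
  cols := w.cols.restrict (a :: w.branch)
  cuts := w.cuts.filter fun u => 0 < w.dual.2.2.2 u

/-- One step of the algorithm. Every free choice (optimal solutions, rays, cuts to add, ties in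
branching, heuristic solutions, order of the nodes) is left open. -/
inductive Step (M M' : ℝ) : S.State → S.State → Prop
  /-- Column generation stops: all reduced costs are nonnegative. -/
  | pricingStop (N : Multiset S.TreeNode) (inc : Option S.Sol) (w : S.Work)
      (q : ∀ g, Option (S.Plan g)) (p : ∀ j, Option (S.Route j))
      (hq : SolvesFirePricing w q) (hp : SolvesCrewPricing w p) (h : NonnegReducedCosts w q p) :
      Step M M' ⟨N, inc, .columnGeneration w⟩ ⟨N, inc, .separation w⟩
  /-- Column generation adds columns and solves the restricted master problem again. -/
  | pricingExpand (N : Multiset S.TreeNode) (inc : Option S.Sol) (w w' : S.Work)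
      (q : ∀ g, Option (S.Plan g)) (p : ∀ j, Option (S.Route j))
      (hq : SolvesFirePricing w q) (hp : SolvesCrewPricing w p) (h : ¬ NonnegReducedCosts w q p)
      (hw : SolvesMaster M' { w with cols := expand w q p } w') :
      Step M M' ⟨N, inc, .columnGeneration w⟩ ⟨N, inc, .columnGeneration w'⟩
  /-- Violated cuts are added, and column generation is run again. -/
  | addCuts (N : Multiset S.TreeNode) (inc : Option S.Sol) (w : S.Work) (x : S.Sol)
      (V : Finset S.Cut) (hx : w.sol = some x) (hV : V.Nonempty)
      (h : ∀ u ∈ V, (S.IsGUBCover u ∨ S.IsAugmentedGUB u) ∧ u.rhs < u.lhs x) :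
      Step M M' ⟨N, inc, .separation w⟩
        ⟨N, inc, .columnGeneration (S.initWork M M' w.branch w.cols (w.cuts ∪ V))⟩
  /-- No cut is added. -/
  | noCuts (N : Multiset S.TreeNode) (inc : Option S.Sol) (w : S.Work) :
      Step M M' ⟨N, inc, .separation w⟩ ⟨N, inc, .evaluation w⟩
  /-- The solution is integer, or has variance zero and is converted into an integer one; it improves
  the upper bound. -/
  | integer (N : Multiset S.TreeNode) (inc : Option S.Sol) (w : S.Work) (x x' : S.Sol)
      (hx : w.sol = some x) (hc : S.costOrTop w.sol < S.costOrTop inc) (h : ZeroVariance x)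
      (hx' : IsIntegerSelection x x') :
      Step M M' ⟨N, inc, .evaluation w⟩ ⟨N, some x', .selection⟩
  /-- The node is infeasible or its cost is not below the upper bound. -/
  | prune (N : Multiset S.TreeNode) (inc : Option S.Sol) (w : S.Work)
      (hc : S.costOrTop inc ≤ S.costOrTop w.sol) :
      Step M M' ⟨N, inc, .evaluation w⟩ ⟨N, inc, .heuristic⟩
  /-- Maximum-variance branching, with any positive weights: `ω = 1`, or the (perturbed) dual prices
  of the linking constraints. -/
  | branch (N : Multiset S.TreeNode) (inc : Option S.Sol) (w : S.Work) (x : S.Sol)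
      (ω : S.Fire → S.Time → ℝ) (a : Bool → S.Branch)
      (hx : w.sol = some x) (hc : S.costOrTop w.sol < S.costOrTop inc) (h : ¬ ZeroVariance x)
      (hω : ∀ g t, 0 < ω g t) (ha : MaxVarianceBranching ω x a) :
      Step M M' ⟨N, inc, .evaluation w⟩
        ⟨child w (a false) ::ₘ child w (a true) ::ₘ N, inc, .heuristic⟩
  /-- The heuristic is not run or does not improve the upper bound. -/
  | heuristicSkip (N : Multiset S.TreeNode) (inc : Option S.Sol) :
      Step M M' ⟨N, inc, .heuristic⟩ ⟨N, inc, .selection⟩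
  /-- The heuristic finds a feasible solution that improves the upper bound. -/
  | heuristicImprove (N : Multiset S.TreeNode) (inc : Option S.Sol) (x : S.Sol)
      (hx : S.IsFeasible x) (hc : S.costOrTop (some x) < S.costOrTop inc) :
      Step M M' ⟨N, inc, .heuristic⟩ ⟨N, some x, .selection⟩
  /-- An unexplored node is selected. -/
  | select (N : Multiset S.TreeNode) (inc : Option S.Sol) (i : S.TreeNode) :
      Step M M' ⟨i ::ₘ N, inc, .selection⟩
        ⟨N, inc, .columnGeneration (S.initWork M M' i.branch i.cols i.cuts)⟩
  /-- All nodes have been explored. -/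
  | finish (inc : Option S.Sol) :
      Step M M' ⟨0, inc, .selection⟩ ⟨0, inc, .returned⟩

/-- The states that the algorithm can reach. -/
def Reachable (M M' : ℝ) (s : S.State) : Prop :=
  Relation.ReflTransGen (Step M M') (S.initState M M') s

end SetPartitioning

/-! ### The wildfire suppression and crew assignment problem -/

/-- The data of the wildfire suppression and crew assignment problem. -/
structure WildfireInstance where
  Fire : Type u
  Crew : Type u
  /-- locations; `fireLoc g` is the location of fire `g` -/
  Loc : Type u
  fireFintype : Fintype Fire
  crewFintype : Fintype Crew
  /-- the number of periods -/
  T : ℕ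
  /-- the number of periods without rest that is allowed, and the length of a rest -/
  φ : ℕ
  γ : ℕ
  fireLoc : Fire ↪ Loc
  /-- `locs j` are the locations that crew `j` can visit, `jurisdiction j` the fires among them -/
  locs : Crew → Finset Loc
  jurisdiction : Crew → Finset Fire
  base : Crew → Loc
  initLoc : Crew → Loc
  base_mem : ∀ j, base j ∈ locs j
  initLoc_mem : ∀ j, initLoc j ∈ locs j
  jurisdiction_mem : ∀ j, ∀ g ∈ jurisdiction j, fireLoc g ∈ locs j
  /-- the time, possibly before the horizon, when the last rest was completed -/
  lastRest : Crew → ℤ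
  travelTime : Loc → Loc → ℝ
  travelCost : Loc → Loc → ℝ
  /-- the cost of the working and resting arcs, between nodes (location, period, rested?) -/
  stayCost : Crew → Loc × ℕ × Bool → Loc × ℕ × Bool → ℝ
  /-- the ordered space of fire states, and its finite discretization `states` -/
  FireState : Fire → Type u
  stateOrder : ∀ g, PartialOrder (FireState g)
  states : ∀ g, Finset (FireState g)
  initFireState : ∀ g, FireState g
  /-- the transition `f_{gt}(s, x)`, the cost `d_{gt}(s, x)` and the terminal cost `h_g(s)` -/
  f : ∀ g, ℕ → FireState g → ℕ → FireState g
  d : ∀ g, ℕ → FireState g → ℕ → ℝ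
  h : ∀ g, FireState g → ℝ

namespace WildfireInstance

attribute [instance] fireFintype crewFintype stateOrder

variable (W : WildfireInstance.{u})

/-- Nodes (location, period, rested?) of the time-space-rest networks. -/
abbrev CrewNode : Type u := W.Loc × ℕ × Bool

/-- The node where crew `j` starts. -/
def crewStart (j : W.Crew) : W.CrewNode := (W.initLoc j, 1, false)

/-- The node set of the time-space-rest network of crew `j`. -/
def crewNodes (j : W.Crew) : Set W.CrewNode :=
  {n | n.1 ∈ W.locs j ∧ 2 ≤ n.2.1 ∧ n.2.1 ≤ W.T + 1} ∪ {W.crewStart j}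

/-- The latest possible rest time. -/
def latestRest (j : W.Crew) : ℤ := min ((W.φ : ℤ) + W.lastRest j) W.T

/-- At this node crew `j` may neither travel nor work, since it has not rested in time. -/
def MustRest (j : W.Crew) (n : W.CrewNode) : Prop := W.latestRest j < n.2.1 ∧ n.2.2 = false

/-- Traveling arcs; the duration is the travel time, rounded up to an element of `{1, …, T}`. -/
def IsTravelArc (j : W.Crew) (n n' : W.CrewNode) : Prop :=
  n.1 ≠ n'.1 ∧ n.2.2 = n'.2.2 ∧ ¬ W.MustRest j n ∧
    ∃ k, IsLeast {τ : ℕ | τ ∈ Finset.Icc 1 W.T ∧ W.travelTime n.1 n'.1 ≤ τ} k ∧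
      n'.2.1 = n.2.1 + k

/-- Working arcs. -/
def IsWorkArc (j : W.Crew) (n n' : W.CrewNode) : Prop :=
  n.1 = n'.1 ∧ (∃ g ∈ W.jurisdiction j, n.1 = W.fireLoc g) ∧ n.2.2 = n'.2.2 ∧
    ¬ W.MustRest j n ∧ n'.2.1 = n.2.1 + 1

/-- Resting arcs, which include shorter times at the base. -/
def IsRestArc (j : W.Crew) (n n' : W.CrewNode) : Prop :=
  n.1 = W.base j ∧ n'.1 = W.base j ∧
    ((n.2.2 = false ∧ n'.2.2 = true ∧ n.2.1 < n'.2.1 ∧ n.2.1 + W.γ ≤ n'.2.1) ∨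
      (n.2.2 = n'.2.2 ∧ n'.2.1 = n.2.1 + 1))

/-- The arcs of the time-space-rest network of crew `j`. -/
def CrewArc (j : W.Crew) (n n' : W.CrewNode) : Prop :=
  n ∈ W.crewNodes j ∧ n' ∈ W.crewNodes j ∧
    (W.IsTravelArc j n n' ∨ W.IsWorkArc j n n' ∨ W.IsRestArc j n n')

/-- The cost of an arc of the time-space-rest network. -/
def crewArcCost (j : W.Crew) (a : W.CrewNode × W.CrewNode) : ℝ :=
  if a.1.1 ≠ a.2.1 then W.travelCost a.1.1 a.2.1 else W.stayCost j a.1 a.2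

/-- The arcs assigned to fire `g` in period `t`: those that leave `(g, t, 0)` or `(g, t, 1)`. -/
def workArcs (j : W.Crew) (g : W.Fire) (t : ℕ) : Set (W.CrewNode × W.CrewNode) :=
  {a | g ∈ W.jurisdiction j ∧ W.CrewArc j a.1 a.2 ∧ a.1.1 = W.fireLoc g ∧ a.1.2.1 = t}

/-- The routes of crew `j`: paths from its start to the sink period `T + 1`. -/
abbrev Route (j : W.Crew) : Type u :=
  NetPath (W.CrewArc j) (W.crewStart j) (fun n => n.2.1 = W.T + 1)

theorem route_finite (j : W.Crew) : Finite (W.Route j) := by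
  refine NetPath.finite (fun n => n.2.1) (W.crewNodes j) ?_ (Or.inr rfl) ?_ (fun a b h => h.2.1)
  · refine Set.Finite.union ?_ (Set.finite_singleton _)
    refine ((W.locs j ×ˢ (Finset.Icc 2 (W.T + 1) ×ˢ
      (Finset.univ : Finset Bool))).finite_toSet).subset ?_
    rintro ⟨l, t, r⟩ ⟨h1, h2, h3⟩
    simp only [Finset.coe_product, Set.mem_prod, Finset.mem_coe, Finset.mem_Icc, Finset.mem_univ]
    exact ⟨h1, ⟨h2, h3⟩, trivial⟩
  · rintro a b ⟨-, -, h | h | h⟩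
    · obtain ⟨-, -, -, k, hk, e⟩ := h
      have := (Finset.mem_Icc.1 hk.1.1).1
      show a.2.1 < b.2.1
      omega
    · have := h.2.2.2.2
      show a.2.1 < b.2.1
      omega
    · obtain ⟨-, -, h | h⟩ := h
      · exact h.2.2.1
      · have := h.2
        show a.2.1 < b.2.1
        omega

/-- Nodes (state, period) of the time-state networks. -/
abbrev FireNode (g : W.Fire) : Type u := W.FireState g × ℕ

/-- The node where fire `g` starts. -/
def fireStart (g : W.Fire) : W.FireNode g := (W.initFireState g, 1)

/-- The node set of the time-state network of fire `g`. -/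
def fireNodes (g : W.Fire) : Set (W.FireNode g) :=
  {n | n.1 ∈ W.states g ∧ 2 ≤ n.2 ∧ n.2 ≤ W.T + 1} ∪ {W.fireStart g}

/-- The numbers of crews, out of those available, that take fire `g` in period `t` from state `s` to
a state that is rounded up to `s'` in the discretization. -/
def crewNumbers (g : W.Fire) (t : ℕ) (s s' : W.FireState g) : Set ℕ :=
  {x | x ≤ Fintype.card W.Crew ∧ IsLeast {σ | σ ∈ W.states g ∧ W.f g t s x ≤ σ} s'}

/-- The arcs of the time-state network of fire `g`. -/
def FireArc (g : W.Fire) (n n' : W.FireNode g) : Prop :=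
  n ∈ W.fireNodes g ∧ n' ∈ W.fireNodes g ∧ n'.2 = n.2 + 1 ∧ (W.crewNumbers g n.2 n.1 n'.1).Nonempty

/-- The minimum number of crews required to traverse an arc. -/
def arcCrews (g : W.Fire) (a : W.FireNode g × W.FireNode g) : ℕ :=
  sInf (W.crewNumbers g a.1.2 a.1.1 a.2.1)

/-- The cost of an arc of the time-state network. -/
def fireArcCost (g : W.Fire) (a : W.FireNode g × W.FireNode g) : ℝ :=
  W.d g a.1.2 a.1.1 (W.arcCrews g a) + if a.1.2 = W.T then W.h g a.2.1 else 0

/-- The suppression plans of fire `g`: paths from its initial state to the sink period `T + 1`. -/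
abbrev Plan (g : W.Fire) : Type u :=
  NetPath (W.FireArc g) (W.fireStart g) (fun n => n.2 = W.T + 1)

theorem plan_finite (g : W.Fire) : Finite (W.Plan g) := by
  refine NetPath.finite (fun n => n.2) (W.fireNodes g) ?_ (Or.inr rfl) ?_ (fun a b h => h.2.1)
  · refine Set.Finite.union ?_ (Set.finite_singleton _)
    refine ((W.states g ×ˢ Finset.Icc 2 (W.T + 1)).finite_toSet).subset ?_
    rintro ⟨s, t⟩ ⟨h1, h2, h3⟩
    simp only [Finset.coe_product, Set.mem_prod, Finset.mem_coe, Finset.mem_Icc]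
    exact ⟨h1, h2, h3⟩
  · rintro a b ⟨-, -, h, -⟩
    show a.2 < b.2
    omega

/-- The two-sided set partitioning problem of the instance. -/
def problem : SetPartitioning.{u} where
  Fire := W.Fire
  Crew := W.Crew
  T := W.T
  Plan := W.Plan
  Route := W.Route
  fireFintype := W.fireFintype
  crewFintype := W.crewFintype
  planFintype g := @Fintype.ofFinite _ (W.plan_finite g)
  routeFintype j := @Fintype.ofFinite _ (W.route_finite j)
  planCost g q := ∑ a ∈ q.arcs, W.fireArcCost g a
  routeCost j p := ∑ a ∈ p.arcs, W.crewArcCost j a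
  A j p g t := if ((p.arcs : Set _) ∩ W.workArcs j g t).Nonempty then 1 else 0
  B g q t := ∑ a ∈ q.arcs.filter fun a => 0 < W.arcCrews g a ∧ a.1.2 = t, W.arcCrews g a

end WildfireInstance

end Wildfire

end

/-! Correctness rests on one invariant, the field `covered` of `Invariant`: every feasible solution
either costs at least as much as the incumbent, or complies with the decisions of an unexplored node
or of the node being processed. At the end no node is left, so nothing feasible is cheaper than the
incumbent. Branching keeps the invariant, because an integer solution satisfies one side of each
disjunction. Closing a node keeps it because of two facts.

First, when pricing stops, the stored cost is a lower bound for all feasible solutions that comply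
with the node (`evaluated_of_reducedCost_nonneg`). This is weak duality over all complying columns,
together with validity of the cuts (`lhs_le_rhs_of_isFeasible`). If no restricted master has been
feasible, the prices are either the initial ones or `M'` times a dual ray. For `M'` large,
nonnegative reduced costs then rule out every complying feasible solution. One `M'` serves all nodes
because only finitely many cuts (`finite_validCuts`) and rays (`finite_rays`) can ever occur; both
finiteness statements say that a polyhedron has finitely many extreme points.

Second, a restricted master optimum `x` of variance zero may be replaced by an integer selection
`x'` from its support at no extra cost (`isFeasible_and_cost_le_of_isIntegerSelection`). Demands and
assignments are constant on the support, so `x'` and `x` agree in every linking and cut constraint.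
Hence `x + ε (x - x')` is feasible for small `ε > 0`, and optimality of `x` gives the comparison of
costs.

No run gets stuck, because linear programs behave as expected: Farkas' lemma yields strong duality
(`exists_le_dualObj`), hence dual optima, and dual rays for infeasible masters; compactness yields
primal optima and extreme rays.

Termination is a lexicographic descent (`rank_lt_of_step`). At positive variance some used column
lies strictly below the mean and another strictly above it, so each child admits fewer columns than
its parent. Within a node, an added cut is new because it is violated, and after the first master
each round of pricing adds a new column. -/

noncomputable section

namespace Wildfire

open Classical

/-! ### Preliminaries on linear inequalities, polyhedra and finite sums. -/

/-- Farkas' lemma, for finitely many linear functionals on a real vector space. -/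
theorem exists_nonneg_sum_smul_eq_of_forall_nonpos {V ι : Type*} [AddCommGroup V] [Module ℝ V]
    (s : Finset ι) (f : ι → V →ₗ[ℝ] ℝ) (c : V →ₗ[ℝ] ℝ)
    (h : ∀ x, (∀ i ∈ s, f i x ≤ 0) → c x ≤ 0) :
    ∃ y : ι → ℝ, (∀ i, 0 ≤ y i) ∧ c = ∑ i ∈ s, y i • f i := by
  induction s using Finset.induction_on generalizing f c with
  | empty =>
    refine ⟨0, fun _ => le_rfl, ?_⟩
    ext x
    have h1 := h x (by simp)
    have h2 := h (-x) (by simp)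
    rw [map_neg] at h2
    simp only [Finset.sum_empty, LinearMap.zero_apply]
    linarith
  | insert a s ha ih =>
    by_cases hs : ∀ x, (∀ i ∈ s, f i x ≤ 0) → c x ≤ 0
    · obtain ⟨y, hy, e⟩ := ih f c hs
      refine ⟨Function.update y a 0, fun i => ?_, ?_⟩
      · by_cases hi : i = a
        · subst hi; simp
        · simp [hi, hy i]
      · rw [Finset.sum_insert ha, e]
        simp only [Function.update_self, zero_smul, zero_add]
        refine Finset.sum_congr rfl fun i hi => ?_
        rw [Function.update_of_ne (ne_of_mem_of_not_mem hi ha)]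
    · push Not at hs
      obtain ⟨x₁, hx₁, hc₁⟩ := hs
      have ha₁ : 0 < f a x₁ := by
        by_contra hn
        exact absurd (h x₁ (by simpa using ⟨not_lt.1 hn, hx₁⟩)) (not_le.2 hc₁)
      -- Normalized so that `f a x₀ = 1`; then `x ↦ x - f a x • x₀` projects onto the kernel of `f
      -- a`.
      set x₀ := (f a x₁)⁻¹ • x₁ with hx₀
      have hinv : 0 < (f a x₁)⁻¹ := inv_pos.2 ha₁
      have hs₀ : ∀ i ∈ s, f i x₀ ≤ 0 := fun i hi => by
        rw [hx₀, map_smul, smul_eq_mul]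
        exact mul_nonpos_of_nonneg_of_nonpos hinv.le (hx₁ i hi)
      have hc₀ : 0 < c x₀ := by
        rw [hx₀, map_smul, smul_eq_mul]; exact mul_pos hinv hc₁
      have ha₀ : f a x₀ = 1 := by
        rw [hx₀, map_smul, smul_eq_mul]; exact inv_mul_cancel₀ ha₁.ne'
      -- The induction hypothesis is applied to the functionals composed with this projection. On
      -- projected points the constraint `a` holds with equality, so it can be dropped.
      obtain ⟨y, hy, e⟩ := ih (fun i => f i - f i x₀ • f a) (c - c x₀ • f a) (by
        intro x hx
        have hfx : ∀ l : V →ₗ[ℝ] ℝ, l (x - f a x • x₀) = l x - l x₀ * f a x := fun l => by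
          rw [map_sub, map_smul, smul_eq_mul, mul_comm]
        have := h (x - f a x • x₀) (by
          intro i hi
          rcases Finset.mem_insert.1 hi with rfl | hi
          · rw [hfx, ha₀]; linarith
          · rw [hfx]; simpa using hx i hi)
        rw [hfx] at this
        simpa using this)
      -- The multiplier of `f a` is what remains when the projected identity is expanded; it is
      -- nonnegative since `c x₀ > 0` and `f i x₀ ≤ 0` on `s`.
      refine ⟨Function.update y a (c x₀ - ∑ i ∈ s, y i * f i x₀), fun i => ?_, ?_⟩
      · by_cases hi : i = a
        · subst hi
          rw [Function.update_self]
          have : ∑ j ∈ s, y j * f j x₀ ≤ 0 := Finset.sum_nonpos fun j hj =>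
            mul_nonpos_of_nonneg_of_nonpos (hy j) (hs₀ j hj)
          linarith
        · simp [hi, hy i]
      · rw [Finset.sum_insert ha, Function.update_self]
        have h1 : ∑ i ∈ s, Function.update y a (c x₀ - ∑ i ∈ s, y i * f i x₀) i • f i
            = ∑ i ∈ s, y i • f i :=
          Finset.sum_congr rfl fun i hi => by rw [Function.update_of_ne (ne_of_mem_of_not_mem hi ha)]
        rw [h1]
        ext x
        have h2 := LinearMap.congr_fun e x
        simp only [LinearMap.sub_apply, LinearMap.smul_apply, LinearMap.sum_apply, smul_eq_mul,
          mul_sub, Finset.sum_sub_distrib, LinearMap.add_apply] at h2 ⊢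
        rw [sub_mul, Finset.sum_mul]
        simp only [mul_assoc] at h2 ⊢
        linarith

/-- A polyhedron has finitely many extreme points. -/
theorem finite_extremePoints_of_polyhedron {E ι : Type*} [AddCommGroup E] [Module ℝ E] [Finite ι]
    (L : Submodule ℝ E) (f : ι → E →ₗ[ℝ] ℝ) (b : ι → ℝ) :
    (Set.extremePoints ℝ {x | x ∈ L ∧ ∀ i, f i x ≤ b i}).Finite := by
  -- An extreme point is determined by its set of tight constraints, and there are finitely many
  -- such sets.
  refine Set.Finite.of_finite_image (f := fun x => {i | f i x = b i}) (Set.toFinite _) ?_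
  intro x hx y hy hxy
  rw [mem_extremePoints] at hx
  have hyA := extremePoints_subset hy
  obtain ⟨hxA, hext⟩ := hx
  have hev : ∀ i, ∀ᶠ ε : ℝ in nhdsWithin 0 (Set.Ioi 0), f i x - ε * (f i y - f i x) ≤ b i := by
    intro i
    by_cases hi : f i x = b i
    · have hi' : f i y = b i := by
        have : i ∈ {i | f i x = b i} := hi
        rw [show {i | f i x = b i} = {i | f i y = b i} from hxy] at this
        exact this
      exact Filter.Eventually.of_forall fun ε => by rw [hi, hi']; simp
    · have hlt : f i x < b i := lt_of_le_of_ne (hxA.2 i) hi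
      have : Filter.Tendsto (fun ε : ℝ => f i x - ε * (f i y - f i x)) (nhdsWithin 0 (Set.Ioi 0))
          (nhds (f i x - 0 * (f i y - f i x))) :=
        (Continuous.tendsto (by fun_prop) 0).mono_left nhdsWithin_le_nhds
      rw [zero_mul, sub_zero] at this
      exact (this.eventually_lt_const hlt).mono fun _ h => h.le
  obtain ⟨ε, hε, hpos⟩ := ((Filter.eventually_all.2 hev).and self_mem_nhdsWithin).exists
  have hpos : 0 < ε := hpos
  -- With equal tight sets, the segment from `y` to `x` can be prolonged a little beyond `x` inside
  -- the polyhedron. So `x` lies in an open segment that ends at `y`, and extremality forces `y =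
  -- x`.
  have := hext (x - ε • (y - x))
    ⟨L.sub_mem hxA.1 (L.smul_mem _ (L.sub_mem hyA.1 hxA.1)), fun i => by simpa using hε i⟩ y hyA
    ⟨1 / (1 + ε), ε / (1 + ε), by positivity, by positivity, by field_simp, by
      have h1 : (1 + ε) ≠ 0 := by positivity
      have : x = (1 / (1 + ε)) • ((1 + ε) • x) := by
        rw [smul_smul, one_div, inv_mul_cancel₀ h1, one_smul]
      conv_rhs => rw [this]
      rw [div_eq_mul_one_div ε, mul_comm ε, mul_smul, ← smul_add]
      congr 1
      module⟩
  exact this.2.symm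

/-- If a finite sum of natural numbers is at most `m + n`, it becomes at most `m` when some `n` of
the summands are dropped. -/
theorem exists_card_le_sum_sdiff_le {α : Type*} (f : α → ℕ) (m n : ℕ) (s : Finset α)
    (h : ∑ a ∈ s, f a ≤ m + n) :
    ∃ R ⊆ s, R.card ≤ n ∧ ∑ a ∈ s \ R, f a ≤ m := by
  induction n generalizing s with
  | zero => exact ⟨∅, by simp, by simp, by simpa using h⟩
  | succ n ih =>
    by_cases hn : ∑ a ∈ s, f a ≤ m + n
    · obtain ⟨R, hR, hc, hm⟩ := ih s hn
      exact ⟨R, hR, by omega, hm⟩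
    · obtain ⟨a, ha, hfa⟩ : ∃ a ∈ s, f a ≠ 0 := by
        by_contra hz
        push Not at hz
        rw [Finset.sum_eq_zero hz] at hn
        omega
      have hsum := Finset.add_sum_erase s f ha
      obtain ⟨R, hR, hc, hm⟩ := ih (s.erase a) (by omega)
      refine ⟨insert a R, Finset.insert_subset ha (hR.trans (s.erase_subset a)),
        (Finset.card_insert_le _ _).trans (by omega), ?_⟩
      convert hm using 2
      ext b
      simp only [Finset.mem_sdiff, Finset.mem_insert, Finset.mem_erase]
      tauto

namespace SetPartitioning

variable {S : SetPartitioning.{u}}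

/-! ### Duality for the restricted master problem -/

/-- The Lagrangian of the restricted master problem, summed by columns and by constraints. -/
theorem sum_values_eq (U : Finset S.Cut) (x : S.Sol) (D : S.Dual) :
    (∑ g, ∑ q, planValue U D g q * x.y g q) + ∑ j, ∑ p, routeValue U D j p * x.z j p =
      (∑ g, D.1 g * ∑ q, x.y g q) + (∑ j, D.2.1 j * ∑ p, x.z j p) +
        (∑ g, ∑ t, D.2.2.1 g t * ((∑ j, ∑ p, (S.A j p g t : ℝ) * x.z j p) -
          ∑ q, (S.B g q t : ℝ) * x.y g q)) - ∑ u ∈ U, D.2.2.2 u * u.lhs x := by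
  have hB : ∑ g, ∑ q, (∑ t, (S.B g q t : ℝ) * D.2.2.1 g t) * x.y g q =
      ∑ g, ∑ t, D.2.2.1 g t * ∑ q, (S.B g q t : ℝ) * x.y g q := by
    refine Finset.sum_congr rfl fun g _ => ?_
    simp only [Finset.sum_mul, Finset.mul_sum]
    rw [Finset.sum_comm]
    exact Finset.sum_congr rfl fun t _ => Finset.sum_congr rfl fun q _ => by ring
  have hA : ∑ j, ∑ p, (∑ g, ∑ t, (S.A j p g t : ℝ) * D.2.2.1 g t) * x.z j p =
      ∑ g, ∑ t, D.2.2.1 g t * ∑ j, ∑ p, (S.A j p g t : ℝ) * x.z j p := by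
    simp only [Finset.sum_mul, Finset.mul_sum]
    have h1 : ∀ j, ∑ p, ∑ g, ∑ t, (S.A j p g t : ℝ) * D.2.2.1 g t * x.z j p =
        ∑ g, ∑ t, ∑ p, (S.A j p g t : ℝ) * D.2.2.1 g t * x.z j p := fun j => by
      rw [Finset.sum_comm]
      exact Finset.sum_congr rfl fun g _ => Finset.sum_comm
    simp only [h1]
    rw [Finset.sum_comm]
    refine Finset.sum_congr rfl fun g _ => ?_
    rw [Finset.sum_comm]
    exact Finset.sum_congr rfl fun t _ => Finset.sum_congr rfl fun j _ =>
      Finset.sum_congr rfl fun p _ => by ring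
  have hy : ∑ g, ∑ q, (∑ u ∈ U, u.planCoef g q * D.2.2.2 u) * x.y g q =
      ∑ u ∈ U, D.2.2.2 u * ∑ g, ∑ q, u.planCoef g q * x.y g q := by
    simp only [Finset.sum_mul, Finset.mul_sum]
    have h1 : ∀ g, ∑ q, ∑ u ∈ U, u.planCoef g q * D.2.2.2 u * x.y g q =
        ∑ u ∈ U, ∑ q, u.planCoef g q * D.2.2.2 u * x.y g q := fun g => Finset.sum_comm
    simp only [h1]
    rw [Finset.sum_comm]
    exact Finset.sum_congr rfl fun t _ => Finset.sum_congr rfl fun j _ =>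
      Finset.sum_congr rfl fun p _ => by ring
  have hz : ∑ j, ∑ p, (∑ u ∈ U, u.routeCoef j p * D.2.2.2 u) * x.z j p =
      ∑ u ∈ U, D.2.2.2 u * ∑ j, ∑ p, u.routeCoef j p * x.z j p := by
    simp only [Finset.sum_mul, Finset.mul_sum]
    have h1 : ∀ j, ∑ p, ∑ u ∈ U, u.routeCoef j p * D.2.2.2 u * x.z j p =
        ∑ u ∈ U, ∑ p, u.routeCoef j p * D.2.2.2 u * x.z j p := fun j => Finset.sum_comm
    simp only [h1]
    rw [Finset.sum_comm]
    exact Finset.sum_congr rfl fun t _ => Finset.sum_congr rfl fun j _ =>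
      Finset.sum_congr rfl fun p _ => by ring
  simp only [planValue, routeValue, sub_mul, add_mul, Finset.sum_sub_distrib,
    Finset.sum_add_distrib, Cut.lhs, mul_add, mul_sub, hA, hB, hy, hz]
  simp only [Finset.mul_sum]
  ring

/-- Weak duality, for arbitrary column costs. -/
theorem dualObj_le_sum_of_value_le {U : Finset S.Cut} {x : S.Sol} {D : S.Dual}
    (hx : S.IsLPFeasible x) (hcut : ∀ u ∈ U, u.lhs x ≤ u.rhs) (hD : IsDualSigned U D)
    (cy : ∀ g, S.Plan g → ℝ) (cz : ∀ j, S.Route j → ℝ)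
    (hy : ∀ g q, x.y g q ≠ 0 → planValue U D g q ≤ cy g q)
    (hz : ∀ j p, x.z j p ≠ 0 → routeValue U D j p ≤ cz j p) :
    dualObj U D ≤ (∑ j, ∑ p, cz j p * x.z j p) + ∑ g, ∑ q, cy g q * x.y g q := by
  have h := sum_values_eq U x D
  simp only [hx.plan, hx.route, mul_one] at h
  have h1 : ∑ g, ∑ q, planValue U D g q * x.y g q ≤ ∑ g, ∑ q, cy g q * x.y g q :=
    Finset.sum_le_sum fun g _ => Finset.sum_le_sum fun q _ => by
      by_cases h0 : x.y g q = 0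
      · simp [h0]
      · exact mul_le_mul_of_nonneg_right (hy g q h0) (hx.y_nonneg g q)
  have h2 : ∑ j, ∑ p, routeValue U D j p * x.z j p ≤ ∑ j, ∑ p, cz j p * x.z j p :=
    Finset.sum_le_sum fun g _ => Finset.sum_le_sum fun q _ => by
      by_cases h0 : x.z g q = 0
      · simp [h0]
      · exact mul_le_mul_of_nonneg_right (hz g q h0) (hx.z_nonneg g q)
  have h3 : 0 ≤ ∑ g, ∑ t, D.2.2.1 g t * ((∑ j, ∑ p, (S.A j p g t : ℝ) * x.z j p) -
          ∑ q, (S.B g q t : ℝ) * x.y g q) :=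
    Finset.sum_nonneg fun g _ => Finset.sum_nonneg fun t _ =>
      mul_nonneg (hD.ρ_nonneg g t) (hx.link g t)
  have h4 : ∑ u ∈ U, D.2.2.2 u * u.lhs x ≤ ∑ u ∈ U, u.rhs * D.2.2.2 u :=
    Finset.sum_le_sum fun u hu => by
      rw [mul_comm]
      exact mul_le_mul_of_nonneg_right (hcut u hu) (hD.α_nonneg u hu)
  unfold dualObj
  linarith

theorem planValue_add (U : Finset S.Cut) (D D' : S.Dual) (g : S.Fire) (q : S.Plan g) :
    planValue U (D + D') g q = planValue U D g q + planValue U D' g q := by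
  simp only [planValue, Prod.fst_add, Prod.snd_add, Pi.add_apply, mul_add, Finset.sum_add_distrib]
  ring

theorem planValue_smul (U : Finset S.Cut) (a : ℝ) (D : S.Dual) (g : S.Fire) (q : S.Plan g) :
    planValue U (a • D) g q = a * planValue U D g q := by
  simp only [planValue, Prod.smul_fst, Prod.smul_snd, Pi.smul_apply, smul_eq_mul, mul_left_comm _ a,
    ← Finset.mul_sum, mul_sub]

theorem routeValue_add (U : Finset S.Cut) (D D' : S.Dual) (j : S.Crew) (p : S.Route j) :
    routeValue U (D + D') j p = routeValue U D j p + routeValue U D' j p := by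
  simp only [routeValue, Prod.fst_add, Prod.snd_add, Pi.add_apply, mul_add, Finset.sum_add_distrib]
  ring

theorem routeValue_smul (U : Finset S.Cut) (a : ℝ) (D : S.Dual) (j : S.Crew) (p : S.Route j) :
    routeValue U (a • D) j p = a * routeValue U D j p := by
  simp only [routeValue, Prod.smul_fst, Prod.smul_snd, Pi.smul_apply, smul_eq_mul,
    mul_left_comm _ a, ← Finset.mul_sum, mul_sub, mul_add]

theorem dualObj_add (U : Finset S.Cut) (D D' : S.Dual) :
    dualObj U (D + D') = dualObj U D + dualObj U D' := by
  simp only [dualObj, Prod.fst_add, Prod.snd_add, Pi.add_apply, mul_add, Finset.sum_add_distrib]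
  ring

theorem dualObj_smul (U : Finset S.Cut) (a : ℝ) (D : S.Dual) :
    dualObj U (a • D) = a * dualObj U D := by
  simp only [dualObj, Prod.smul_fst, Prod.smul_snd, Pi.smul_apply, smul_eq_mul,
    mul_left_comm _ a, ← Finset.mul_sum, mul_sub, mul_add]

/-- `planValue` as a linear functional of the dual vector. -/
def planValueₗ (U : Finset S.Cut) (g : S.Fire) (q : S.Plan g) : S.Dual →ₗ[ℝ] ℝ where
  toFun D := planValue U D g q
  map_add' D D' := planValue_add U D D' g q
  map_smul' a D := planValue_smul U a D g q

/-- `routeValue` as a linear functional of the dual vector. -/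
def routeValueₗ (U : Finset S.Cut) (j : S.Crew) (p : S.Route j) : S.Dual →ₗ[ℝ] ℝ where
  toFun D := routeValue U D j p
  map_add' D D' := routeValue_add U D D' j p
  map_smul' a D := routeValue_smul U a D j p

/-- `dualObj` as a linear functional of the dual vector. -/
def dualObjₗ (U : Finset S.Cut) : S.Dual →ₗ[ℝ] ℝ where
  toFun D := dualObj U D
  map_add' D D' := dualObj_add U D D'
  map_smul' a D := dualObj_smul U a D

/-- The dual price of a linking constraint as a linear functional of the dual vector. -/
def linkPriceₗ (g : S.Fire) (t : S.Time) : S.Dual →ₗ[ℝ] ℝ where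
  toFun D := D.2.2.1 g t
  map_add' _ _ := rfl
  map_smul' _ _ := rfl

/-- The dual price of a cut as a linear functional of the dual vector. -/
def cutPriceₗ (u : S.Cut) : S.Dual →ₗ[ℝ] ℝ where
  toFun D := D.2.2.2 u
  map_add' _ _ := rfl
  map_smul' _ _ := rfl

@[simp] theorem planValueₗ_apply (U : Finset S.Cut) (g : S.Fire) (q : S.Plan g) (D : S.Dual) :
    planValueₗ U g q D = planValue U D g q := rfl

@[simp] theorem routeValueₗ_apply (U : Finset S.Cut) (j : S.Crew) (p : S.Route j) (D : S.Dual) :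
    routeValueₗ U j p D = routeValue U D j p := rfl

@[simp] theorem dualObjₗ_apply (U : Finset S.Cut) (D : S.Dual) : dualObjₗ U D = dualObj U D := rfl

@[simp] theorem linkPriceₗ_apply (g : S.Fire) (t : S.Time) (D : S.Dual) :
    linkPriceₗ g t D = D.2.2.1 g t := rfl

@[simp] theorem cutPriceₗ_apply (u : S.Cut) (D : S.Dual) : cutPriceₗ u D = D.2.2.2 u := rfl

/-- The dual vector with the prices of the cuts outside `U` set to zero. -/
def Dual.restrictCuts (U : Finset S.Cut) (D : S.Dual) : S.Dual :=
  (D.1, D.2.1, D.2.2.1, fun u => if u ∈ U then D.2.2.2 u else 0)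

theorem planValue_restrictCuts (U : Finset S.Cut) (D : S.Dual) (g : S.Fire) (q : S.Plan g) :
    planValue U (Dual.restrictCuts U D) g q = planValue U D g q := by
  unfold planValue Dual.restrictCuts
  simp only
  congr 1
  exact Finset.sum_congr rfl fun u hu => by rw [if_pos hu]

theorem routeValue_restrictCuts (U : Finset S.Cut) (D : S.Dual) (j : S.Crew) (p : S.Route j) :
    routeValue U (Dual.restrictCuts U D) j p = routeValue U D j p := by
  unfold routeValue Dual.restrictCuts
  simp only
  congr 1
  exact Finset.sum_congr rfl fun u hu => by rw [if_pos hu]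

theorem dualObj_restrictCuts (U : Finset S.Cut) (D : S.Dual) :
    dualObj U (Dual.restrictCuts U D) = dualObj U D := by
  unfold dualObj Dual.restrictCuts
  simp only
  congr 1
  exact Finset.sum_congr rfl fun u hu => by rw [if_pos hu]

/-- Strong duality, for arbitrary column costs: a lower bound on the cost of all feasible solutions
is attained by a dual solution. If there is no feasible solution, this holds for every bound. -/
theorem exists_le_dualObj (C : S.Columns) (U : Finset S.Cut) (cy : ∀ g, S.Plan g → ℝ)
    (cz : ∀ j, S.Route j → ℝ) (v : ℝ)
    (hv : ∀ x, S.IsRMPFeasible C U x →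
      v ≤ (∑ j, ∑ p, cz j p * x.z j p) + ∑ g, ∑ q, cy g q * x.y g q) :
    ∃ D : S.Dual, IsDualSigned U D ∧ (∀ g, ∀ q ∈ C.Q g, planValue U D g q ≤ cy g q) ∧
      (∀ j, ∀ p ∈ C.P j, routeValue U D j p ≤ cz j p) ∧ v ≤ dualObj U D := by
  by_contra hno
  -- The dual system is homogenized by an extra variable `τ`, and Farkas' lemma is applied to `τ ≤
  -- 0`. The index `true` carries the condition on the objective; `false` is padding.
  let ι := (Σ g, S.Plan g) ⊕ (Σ j, S.Route j) ⊕ (S.Fire × S.Time) ⊕ U ⊕ Bool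
  let π₁ : S.Dual × ℝ →ₗ[ℝ] S.Dual := LinearMap.fst ℝ _ _
  let π₂ : S.Dual × ℝ →ₗ[ℝ] ℝ := LinearMap.snd ℝ _ _
  let f : ι → S.Dual × ℝ →ₗ[ℝ] ℝ := fun i => match i with
    | .inl a => if a.2 ∈ C.Q a.1 then planValueₗ U a.1 a.2 ∘ₗ π₁ - cy a.1 a.2 • π₂ else 0
    | .inr (.inl a) => if a.2 ∈ C.P a.1 then routeValueₗ U a.1 a.2 ∘ₗ π₁ - cz a.1 a.2 • π₂ else 0
    | .inr (.inr (.inl a)) => - (linkPriceₗ a.1 a.2 ∘ₗ π₁)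
    | .inr (.inr (.inr (.inl u))) => - (cutPriceₗ u.1 ∘ₗ π₁)
    | .inr (.inr (.inr (.inr true))) => v • π₂ - dualObjₗ U ∘ₗ π₁
    | .inr (.inr (.inr (.inr false))) => 0
  obtain ⟨m, hm, e⟩ := exists_nonneg_sum_smul_eq_of_forall_nonpos (Finset.univ : Finset ι) f π₂ (by
    rintro ⟨D, τ⟩ h
    by_contra hτ
    have hτ : 0 < τ := not_le.1 hτ
    have hinv : 0 < τ⁻¹ := inv_pos.2 hτ
    -- A solution with `τ > 0` would rescale to the dual vector that is assumed not to exist.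
    -- Vanishing off `U` may amount to infinitely many equations, so it is obtained by truncation
    -- and not as a Farkas constraint.
    refine hno ⟨Dual.restrictCuts U (τ⁻¹ • D), ⟨fun g t => ?_, fun u hu => ?_, fun u hu => ?_⟩,
      fun g q hq => ?_, fun j p hp => ?_, ?_⟩
    · have := h (.inr (.inr (.inl (g, t)))) (Finset.mem_univ _)
      have : 0 ≤ D.2.2.1 g t := by simpa [f, π₁] using this
      exact mul_nonneg hinv.le this
    · have := h (.inr (.inr (.inr (.inl ⟨u, hu⟩)))) (Finset.mem_univ _)
      have : 0 ≤ D.2.2.2 u := by simpa [f, π₁] using this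
      simp only [Dual.restrictCuts, if_pos hu]
      exact mul_nonneg hinv.le this
    · simp only [Dual.restrictCuts, if_neg hu]
    · have := h (.inl ⟨g, q⟩) (Finset.mem_univ _)
      have : planValue U D g q ≤ cy g q * τ := by simpa [f, π₁, π₂, hq] using this
      rw [planValue_restrictCuts, planValue_smul, inv_mul_le_iff₀ hτ]
      linarith
    · have := h (.inr (.inl ⟨j, p⟩)) (Finset.mem_univ _)
      have : routeValue U D j p ≤ cz j p * τ := by simpa [f, π₁, π₂, hp] using this
      rw [routeValue_restrictCuts, routeValue_smul, inv_mul_le_iff₀ hτ]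
      linarith
    · have := h (.inr (.inr (.inr (.inr true)))) (Finset.mem_univ _)
      have : v * τ ≤ dualObj U D := by simpa [f, π₁, π₂] using this
      rw [dualObj_restrictCuts, dualObj_smul, le_inv_mul_iff₀ hτ]
      linarith)
  -- The multipliers of the column constraints form an unnormalized primal solution; the multiplier
  -- `l` of the objective is its scale.
  let x : S.Sol :=
    ⟨fun g q => if q ∈ C.Q g then m (.inl ⟨g, q⟩) else 0,
      fun j p => if p ∈ C.P j then m (.inr (.inl ⟨j, p⟩)) else 0⟩
  let c : S.Sol → ℝ := fun x => (∑ j, ∑ p, cz j p * x.z j p) + ∑ g, ∑ q, cy g q * x.y g q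
  set l : ℝ := m (.inr (.inr (.inr (.inr true)))) with hl
  -- The Farkas identity, evaluated at an arbitrary dual vector. Evaluation at the unit vectors
  -- below gives the primal constraints with right-hand sides scaled by `l`.
  have key : ∀ (D : S.Dual) (τ : ℝ), τ =
      ((∑ g, ∑ q, planValue U D g q * x.y g q) + ∑ j, ∑ p, routeValue U D j p * x.z j p)
      - τ * c x - (∑ g, ∑ t, m (.inr (.inr (.inl (g, t)))) * D.2.2.1 g t)
      - (∑ u : U, m (.inr (.inr (.inr (.inl u)))) * D.2.2.2 u) + l * (v * τ - dualObj U D) := by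
    intro D τ
    have h := LinearMap.congr_fun e (D, τ)
    rw [LinearMap.sum_apply] at h
    simp only [LinearMap.smul_apply, ι, Fintype.sum_sum_type,
      Fintype.sum_sigma, Fintype.sum_prod_type, Fintype.sum_bool] at h
    have h1 : ∀ g q, m (.inl ⟨g, q⟩) • f (.inl ⟨g, q⟩) (D, τ) =
        planValue U D g q * x.y g q - τ * (cy g q * x.y g q) := by
      intro g q
      by_cases hq : q ∈ C.Q g
      · simp [f, x, hq, π₁, π₂]; ring
      · simp [f, x, hq]
    have h2 : ∀ j p, m (.inr (.inl ⟨j, p⟩)) • f (.inr (.inl ⟨j, p⟩)) (D, τ) =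
        routeValue U D j p * x.z j p - τ * (cz j p * x.z j p) := by
      intro g q
      by_cases hq : q ∈ C.P g
      · simp [f, x, hq, π₁, π₂]; ring
      · simp [f, x, hq]
    simp only [h1, h2, Finset.sum_sub_distrib, ← Finset.mul_sum] at h
    simp only [f, π₁, π₂, LinearMap.neg_apply, LinearMap.comp_apply, LinearMap.fst_apply,
      LinearMap.snd_apply, LinearMap.sub_apply, LinearMap.smul_apply, LinearMap.zero_apply,
      linkPriceₗ_apply, cutPriceₗ_apply, dualObjₗ_apply, smul_eq_mul, mul_neg,
      Finset.sum_neg_distrib, mul_zero, ← hl] at h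
    simp only [c]
    linarith
  have hxy : ∀ g q, 0 ≤ x.y g q := fun g q => by
    simp only [x]; split_ifs; exacts [hm _, le_rfl]
  have hxz : ∀ g q, 0 ≤ x.z g q := fun g q => by
    simp only [x]; split_ifs; exacts [hm _, le_rfl]
  simp only [sum_values_eq] at key
  have hcost : 1 = - c x + l * v := by
    have := key 0 1
    simp [dualObj] at this
    linarith
  have hplan : ∀ g, ∑ q, x.y g q = l := fun g => by
    have := key (Pi.single g 1, 0, 0, 0) 0
    simp [dualObj, Pi.single_apply] at this
    linarith
  have hroute : ∀ j, ∑ p, x.z j p = l := fun j => by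
    have := key (0, Pi.single j 1, 0, 0) 0
    simp [dualObj, Pi.single_apply] at this
    linarith
  have hlink : ∀ g t, 0 ≤ (∑ j, ∑ p, (S.A j p g t : ℝ) * x.z j p) -
      ∑ q, (S.B g q t : ℝ) * x.y g q := fun g t => by
    have := key (0, 0, Pi.single g (Pi.single t 1), 0) 0
    have h1 : ∀ F : S.Fire → S.Time → ℝ, ∑ g', ∑ t',
        (Pi.single g (Pi.single t 1) : S.Fire → S.Time → ℝ) g' t' * F g' t' = F g t := fun F => by
      rw [Finset.sum_eq_single g (fun b _ hb => by simp [hb]) (by simp)]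
      rw [Finset.sum_eq_single t (fun b _ hb => by simp [hb]) (by simp)]
      simp
    have h2 : ∀ F : S.Fire → S.Time → ℝ, ∑ g', ∑ t',
        F g' t' * (Pi.single g (Pi.single t 1) : S.Fire → S.Time → ℝ) g' t' = F g t := fun F => by
      rw [← h1 F]; simp only [mul_comm]
    rw [h1 (fun g t => (∑ j, ∑ p, (S.A j p g t : ℝ) * x.z j p) -
      ∑ q, (S.B g q t : ℝ) * x.y g q), h2 (fun g t => m (.inr (.inr (.inl (g, t)))))] at this
    simp [dualObj] at this
    have := hm (.inr (.inr (.inl (g, t))))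
    linarith
  have hcut : ∀ u ∈ U, u.lhs x ≤ l * u.rhs := fun u hu => by
    have := key (0, 0, 0, Pi.single u 1) 0
    have h1 : ∑ u' : U, m (.inr (.inr (.inr (.inl u')))) * (Pi.single u 1 : S.Cut → ℝ) u' =
        m (.inr (.inr (.inr (.inl ⟨u, hu⟩)))) := by
      rw [Finset.sum_eq_single ⟨u, hu⟩ (fun b _ hb => by
        have : (b : S.Cut) ≠ u := fun e => hb (Subtype.ext e)
        simp [this]) (by simp)]
      simp
    simp only [h1] at this
    simp [dualObj, Pi.single_apply, hu] at this
    have := hm (.inr (.inr (.inr (.inl ⟨u, hu⟩))))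
    linarith
  have hl0 : 0 ≤ l := hm _
  -- If `l = 0`, then `x = 0`, against `1 = - c x + l * v`. If `l > 0`, then `x / l` is feasible and
  -- costs `v - 1 / l`, less than the assumed bound `v`.
  rcases hl0.eq_or_lt with h0 | hpos
  · have hy0 : ∀ g q, x.y g q = 0 := fun g q =>
      (Finset.sum_eq_zero_iff_of_nonneg fun q _ => hxy g q).1 ((hplan g).trans h0.symm) q
        (Finset.mem_univ _)
    have hz0 : ∀ g q, x.z g q = 0 := fun g q =>
      (Finset.sum_eq_zero_iff_of_nonneg fun q _ => hxz g q).1 ((hroute g).trans h0.symm) q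
        (Finset.mem_univ _)
    simp [c, hy0, hz0, ← h0] at hcost
  · have hinv : 0 < l⁻¹ := inv_pos.2 hpos
    have hll : l⁻¹ * l = 1 := inv_mul_cancel₀ hpos.ne'
    let x' : S.Sol := ⟨fun g q => l⁻¹ * x.y g q, fun j p => l⁻¹ * x.z j p⟩
    have hx' : S.IsRMPFeasible C U x' := by
      refine ⟨⟨fun g => ?_, fun j => ?_, fun g t => ?_, fun g q => ?_, fun g q => ?_⟩,
        fun g q hq => ?_, fun g q hq => ?_, fun u hu => ?_⟩
      · simp only [x', ← Finset.mul_sum, hplan, hll]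
      · simp only [x', ← Finset.mul_sum, hroute, hll]
      · have := mul_nonneg hinv.le (hlink g t)
        simpa only [x', mul_left_comm _ l⁻¹, ← Finset.mul_sum, ← mul_sub] using this
      · exact mul_nonneg hinv.le (hxz g q)
      · exact mul_nonneg hinv.le (hxy g q)
      · simp [x', x, hq]
      · simp [x', x, hq]
      · have : u.lhs x' = l⁻¹ * u.lhs x := by
          simp only [Cut.lhs, x', mul_left_comm _ l⁻¹, ← Finset.mul_sum, ← mul_add]
        rw [this, inv_mul_le_iff₀ hpos]
        exact hcut u hu
    have h1 := hv x' hx'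
    have h2 : (∑ j, ∑ p, cz j p * x'.z j p) + ∑ g, ∑ q, cy g q * x'.y g q = l⁻¹ * c x := by
      simp only [c, x', mul_left_comm _ l⁻¹, ← Finset.mul_sum, ← mul_add]
    rw [h2, le_inv_mul_iff₀ hpos] at h1
    linarith

/-! ### Existence of optimal solutions and of extreme rays -/

theorem IsLPFeasible.y_le_one {x : S.Sol} (hx : S.IsLPFeasible x) (g : S.Fire) (q : S.Plan g) :
    x.y g q ≤ 1 := by
  rw [← hx.plan g]
  exact Finset.single_le_sum (fun q _ => hx.y_nonneg g q) (Finset.mem_univ q)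

theorem IsLPFeasible.z_le_one {x : S.Sol} (hx : S.IsLPFeasible x) (j : S.Crew) (p : S.Route j) :
    x.z j p ≤ 1 := by
  rw [← hx.route j]
  exact Finset.single_le_sum (fun p _ => hx.z_nonneg j p) (Finset.mem_univ p)

theorem IsFeasible.isLPFeasible {x : S.Sol} (hx : S.IsFeasible x) : S.IsLPFeasible x where
  plan := hx.plan
  route := hx.route
  link := hx.link
  z_nonneg j p := by rcases hx.z_binary j p with h | h <;> rw [h]; exact zero_le_one
  y_nonneg j p := by rcases hx.y_binary j p with h | h <;> rw [h]; exact zero_le_one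

/-- The partitioning constraints confine the feasible set to a product of unit intervals, so it is
compact and the continuous cost attains its minimum. -/
theorem exists_isRMPOptimal {C : S.Columns} {U : Finset S.Cut}
    (h : ∃ x, S.IsRMPFeasible C U x) : ∃ x, S.IsRMPOptimal C U x := by
  let K : Set ((∀ g, S.Plan g → ℝ) × (∀ j, S.Route j → ℝ)) := {v | S.IsRMPFeasible C U ⟨v.1, v.2⟩}
  have hsub : K ⊆ (Set.univ.pi fun _ => Set.univ.pi fun _ => Set.Icc (0 : ℝ) 1) ×ˢ
      (Set.univ.pi fun _ => Set.univ.pi fun _ => Set.Icc (0 : ℝ) 1) := by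
    intro v hv
    exact ⟨fun g _ q _ => ⟨hv.lp.y_nonneg g q, hv.lp.y_le_one g q⟩,
      fun j _ p _ => ⟨hv.lp.z_nonneg j p, hv.lp.z_le_one j p⟩⟩
  have hK : K = (⋂ g, {v | ∑ q, v.1 g q = 1}) ∩ (⋂ j, {v | ∑ p, v.2 j p = 1}) ∩
      (⋂ g, ⋂ t, {v | 0 ≤ (∑ j, ∑ p, (S.A j p g t : ℝ) * v.2 j p) -
        ∑ q, (S.B g q t : ℝ) * v.1 g q}) ∩
      (⋂ j, ⋂ p, {v | 0 ≤ v.2 j p}) ∩ (⋂ g, ⋂ q, {v | 0 ≤ v.1 g q}) ∩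
      (⋂ g, ⋂ q, ⋂ _ : q ∉ C.Q g, {v | v.1 g q = 0}) ∩
      (⋂ j, ⋂ p, ⋂ _ : p ∉ C.P j, {v | v.2 j p = 0}) ∩
      (⋂ u, ⋂ _ : u ∈ U, {v | (∑ g, ∑ q, u.planCoef g q * v.1 g q) +
        ∑ j, ∑ p, u.routeCoef j p * v.2 j p ≤ u.rhs}) := by
    ext v
    simp only [Set.mem_inter_iff, Set.mem_iInter, Set.mem_ofPred_eq]
    constructor
    · intro hv
      exact ⟨⟨⟨⟨⟨⟨⟨hv.lp.plan, hv.lp.route⟩, hv.lp.link⟩, hv.lp.z_nonneg⟩, hv.lp.y_nonneg⟩,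
        hv.y_supp⟩, hv.z_supp⟩, hv.cuts⟩
    · rintro ⟨⟨⟨⟨⟨⟨⟨h1, h2⟩, h3⟩, h4⟩, h5⟩, h6⟩, h7⟩, h8⟩
      exact ⟨⟨h1, h2, h3, h4, h5⟩, h6, h7, h8⟩
  have hclosed : IsClosed K := by
    rw [hK]
    refine ((((((IsClosed.inter ?_ ?_).inter ?_).inter ?_).inter ?_).inter ?_).inter ?_).inter ?_
    · exact isClosed_iInter fun _ => isClosed_eq (by fun_prop) (by fun_prop)
    · exact isClosed_iInter fun _ => isClosed_eq (by fun_prop) (by fun_prop)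
    · exact isClosed_iInter fun _ => isClosed_iInter fun _ => isClosed_le (by fun_prop) (by fun_prop)
    · exact isClosed_iInter fun _ => isClosed_iInter fun _ => isClosed_le (by fun_prop) (by fun_prop)
    · exact isClosed_iInter fun _ => isClosed_iInter fun _ => isClosed_le (by fun_prop) (by fun_prop)
    · exact isClosed_iInter fun _ => isClosed_iInter fun _ => isClosed_iInter fun _ =>
        isClosed_eq (by fun_prop) (by fun_prop)
    · exact isClosed_iInter fun _ => isClosed_iInter fun _ => isClosed_iInter fun _ =>
        isClosed_eq (by fun_prop) (by fun_prop)
    · exact isClosed_iInter fun _ => isClosed_iInter fun _ => isClosed_le (by fun_prop) (by fun_prop)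
  have hcomp : IsCompact K := IsCompact.of_isClosed_subset
    ((isCompact_univ_pi fun _ => isCompact_univ_pi fun _ => isCompact_Icc).prod
      (isCompact_univ_pi fun _ => isCompact_univ_pi fun _ => isCompact_Icc)) hclosed hsub
  obtain ⟨x₀, hx₀⟩ := h
  have hcont : Continuous fun v : (∀ g, S.Plan g → ℝ) × (∀ j, S.Route j → ℝ) => S.cost ⟨v.1, v.2⟩ := by
    unfold cost; fun_prop
  obtain ⟨v, hv, hmin⟩ := hcomp.exists_isMinOn ⟨(x₀.y, x₀.z), hx₀⟩ hcont.continuousOn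
  exact ⟨⟨v.1, v.2⟩, hv, fun x' hx' => hmin (show (x'.y, x'.z) ∈ K from hx')⟩

theorem dualObj_le_cost {C : S.Columns} {U : Finset S.Cut} {x : S.Sol} {D : S.Dual}
    (hx : S.IsRMPFeasible C U x) (hD : IsDualFeasible C U D) : dualObj U D ≤ S.cost x :=
  dualObj_le_sum_of_value_le hx.lp hx.cuts hD.signed _ _
    (fun g q h => hD.plan g q (by by_contra hq; exact h (hx.y_supp g q hq)))
    (fun g q h => hD.route g q (by by_contra hq; exact h (hx.z_supp g q hq)))

theorem exists_isDualFeasible_cost_le {C : S.Columns} {U : Finset S.Cut} {x : S.Sol}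
    (hx : S.IsRMPOptimal C U x) : ∃ D, IsDualFeasible C U D ∧ S.cost x ≤ dualObj U D := by
  obtain ⟨D, h1, h2, h3, h4⟩ := exists_le_dualObj C U S.planCost S.routeCost (S.cost x) hx.2
  exact ⟨D, ⟨h1, h2, h3⟩, h4⟩

theorem exists_isDualOptimal {C : S.Columns} {U : Finset S.Cut} {x : S.Sol}
    (hx : S.IsRMPOptimal C U x) : ∃ D, IsDualOptimal C U D := by
  obtain ⟨D, hD, h⟩ := exists_isDualFeasible_cost_le hx
  exact ⟨D, hD, fun D' hD' => (dualObj_le_cost hx.1 hD').trans h⟩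

theorem cost_le_dualObj {C : S.Columns} {U : Finset S.Cut} {x : S.Sol} {D : S.Dual}
    (hx : S.IsRMPOptimal C U x) (hD : IsDualOptimal C U D) : S.cost x ≤ dualObj U D := by
  obtain ⟨D', hD', h⟩ := exists_isDualFeasible_cost_le hx
  exact h.trans (hD.2 D' hD')

/-- `dualObj` as a continuous linear functional. -/
def dualObjL (U : Finset S.Cut) : S.Dual →L[ℝ] ℝ where
  toLinearMap := dualObjₗ U
  cont := by
    show Continuous fun D : S.Dual => dualObj U D
    unfold dualObj; fun_prop

theorem dualCone_smul {C : S.Columns} {U : Finset S.Cut} {D : S.Dual} (hD : D ∈ dualCone C U)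
    {a : ℝ} (ha : 0 ≤ a) : a • D ∈ dualCone C U := by
  obtain ⟨h1, h2, h3⟩ := hD
  refine ⟨⟨fun g t => mul_nonneg ha (h1.ρ_nonneg g t), fun u hu => mul_nonneg ha (h1.α_nonneg u hu),
    fun u hu => ?_⟩, fun g q hq => ?_, fun j p hp => ?_⟩
  · show a * D.2.2.2 u = 0
    rw [h1.α_supp u hu, mul_zero]
  · rw [planValue_smul]; exact mul_nonpos_of_nonneg_of_nonpos ha (h2 g q hq)
  · rw [routeValue_smul]; exact mul_nonpos_of_nonneg_of_nonpos ha (h3 j p hp)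

theorem dualNorm_smul (U : Finset S.Cut) (D : S.Dual) {a : ℝ} (ha : 0 ≤ a) :
    dualNorm U (a • D) = a * dualNorm U D := by
  simp only [dualNorm, Prod.smul_fst, Prod.smul_snd, Pi.smul_apply, smul_eq_mul, abs_mul,
    abs_of_nonneg ha, ← Finset.mul_sum, mul_add]

theorem dualNorm_nonneg (U : Finset S.Cut) (D : S.Dual) : 0 ≤ dualNorm U D := by
  unfold dualNorm; positivity

/-- The norm sees only the cuts of `U`; the other coordinates vanish by `α_supp`. So the set is
closed in a product of copies of `[-1, 1]`, compact even if there are infinitely many coordinates.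
-/
theorem isCompact_dualCone_inter_ball (C : S.Columns) (U : Finset S.Cut) :
    IsCompact {D : S.Dual | D ∈ dualCone C U ∧ dualNorm U D ≤ 1} := by
  let K : Set S.Dual := {D | D ∈ dualCone C U ∧ dualNorm U D ≤ 1}
  have hsub : K ⊆ (Set.univ.pi fun _ => Set.Icc (-1 : ℝ) 1) ×ˢ
      ((Set.univ.pi fun _ => Set.Icc (-1 : ℝ) 1) ×ˢ
      ((Set.univ.pi fun _ => Set.univ.pi fun _ => Set.Icc (-1 : ℝ) 1) ×ˢ
        (Set.univ.pi fun _ => Set.Icc (-1 : ℝ) 1))) := by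
    rintro D ⟨hD, hn⟩
    unfold dualNorm at hn
    have p1 : 0 ≤ ∑ g, |D.1 g| := by positivity
    have p2 : 0 ≤ ∑ g, |D.2.1 g| := by positivity
    have p3 : 0 ≤ ∑ g, ∑ t, |D.2.2.1 g t| := by positivity
    have p4 : 0 ≤ ∑ u ∈ U, |D.2.2.2 u| := by positivity
    refine ⟨fun g _ => abs_le.1 ?_, fun g _ => abs_le.1 ?_, fun g _ t _ => abs_le.1 ?_,
      fun u _ => abs_le.1 ?_⟩
    · have := Finset.single_le_sum (f := fun g => |D.1 g|) (fun _ _ => abs_nonneg _)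
        (Finset.mem_univ g)
      linarith
    · have := Finset.single_le_sum (f := fun g => |D.2.1 g|) (fun _ _ => abs_nonneg _)
        (Finset.mem_univ g)
      linarith
    · have h1 := Finset.single_le_sum (f := fun g => ∑ t, |D.2.2.1 g t|) (fun _ _ => by positivity)
        (Finset.mem_univ g)
      have h2 := Finset.single_le_sum (f := fun t => |D.2.2.1 g t|) (fun _ _ => abs_nonneg _)
        (Finset.mem_univ t)
      linarith
    · by_cases hu : u ∈ U
      · have := Finset.single_le_sum (f := fun u => |D.2.2.2 u|) (fun _ _ => abs_nonneg _) hu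
        linarith
      · rw [hD.1.α_supp u hu]; simp
  have hK : K = (⋂ g, ⋂ t, {D : S.Dual | 0 ≤ D.2.2.1 g t}) ∩
      (⋂ u, ⋂ _ : u ∈ U, {D : S.Dual | 0 ≤ D.2.2.2 u}) ∩
      (⋂ u, ⋂ _ : u ∉ U, {D : S.Dual | D.2.2.2 u = 0}) ∩
      (⋂ g, ⋂ q, ⋂ _ : q ∈ C.Q g, {D : S.Dual | planValue U D g q ≤ 0}) ∩
      (⋂ j, ⋂ p, ⋂ _ : p ∈ C.P j, {D : S.Dual | routeValue U D j p ≤ 0}) ∩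
      {D : S.Dual | dualNorm U D ≤ 1} := by
    ext D
    simp only [Set.mem_inter_iff, Set.mem_iInter, Set.mem_ofPred_eq]
    constructor
    · rintro ⟨⟨⟨h1, h2, h3⟩, h4, h5⟩, h6⟩
      exact ⟨⟨⟨⟨⟨h1, h2⟩, h3⟩, h4⟩, h5⟩, h6⟩
    · rintro ⟨⟨⟨⟨⟨h1, h2⟩, h3⟩, h4⟩, h5⟩, h6⟩
      exact ⟨⟨⟨h1, h2, h3⟩, h4, h5⟩, h6⟩
  have hclosed : IsClosed K := by
    rw [hK]
    refine ((((IsClosed.inter ?_ ?_).inter ?_).inter ?_).inter ?_).inter ?_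
    · exact isClosed_iInter fun _ => isClosed_iInter fun _ => isClosed_le (by fun_prop) (by fun_prop)
    · exact isClosed_iInter fun _ => isClosed_iInter fun _ => isClosed_le (by fun_prop) (by fun_prop)
    · exact isClosed_iInter fun _ => isClosed_iInter fun _ => isClosed_eq (by fun_prop) (by fun_prop)
    · exact isClosed_iInter fun _ => isClosed_iInter fun _ => isClosed_iInter fun _ =>
        isClosed_le (by unfold planValue; fun_prop) (by fun_prop)
    · exact isClosed_iInter fun _ => isClosed_iInter fun _ => isClosed_iInter fun _ =>
        isClosed_le (by unfold routeValue; fun_prop) (by fun_prop)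
    · exact isClosed_le (by unfold dualNorm; fun_prop) (by fun_prop)
  exact IsCompact.of_isClosed_subset ((isCompact_univ_pi fun _ => isCompact_Icc).prod
    ((isCompact_univ_pi fun _ => isCompact_Icc).prod
      ((isCompact_univ_pi fun _ => isCompact_univ_pi fun _ => isCompact_Icc).prod
        (isCompact_univ_pi fun _ => isCompact_Icc)))) hclosed hsub

/-- Strong duality with zero costs and bound 1 yields a dual ray of positive objective, which is
shrunk into the unit ball. The face of the compact section on which the objective is maximal has an
extreme point by Krein–Milman, and this is also extreme in the section. The cone need not be
pointed. -/
theorem exists_isNormalizedExtremeRay {C : S.Columns} {U : Finset S.Cut}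
    (h : ∀ x, ¬ S.IsRMPFeasible C U x) : ∃ D, IsNormalizedExtremeRay C U D := by
  obtain ⟨D₀, h1, h2, h3, h4⟩ := exists_le_dualObj C U (fun _ _ => 0) (fun _ _ => 0) 1
    (fun x hx => absurd hx (h x))
  set K : Set S.Dual := {D | D ∈ dualCone C U ∧ dualNorm U D ≤ 1} with hK
  have hcomp : IsCompact K := isCompact_dualCone_inter_ball C U
  have hn := dualNorm_nonneg U D₀
  have hpos : 0 < (1 + dualNorm U D₀)⁻¹ := by positivity
  have hD₁ : (1 + dualNorm U D₀)⁻¹ • D₀ ∈ K := by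
    refine ⟨dualCone_smul ⟨h1, h2, h3⟩ hpos.le, ?_⟩
    rw [dualNorm_smul _ _ hpos.le, inv_mul_le_iff₀ (by positivity)]
    linarith
  have hobj : 0 < dualObj U ((1 + dualNorm U D₀)⁻¹ • D₀) := by
    rw [dualObj_smul]; exact mul_pos hpos (by linarith)
  obtain ⟨D₂, hD₂, hmax⟩ := hcomp.exists_isMaxOn ⟨_, hD₁⟩ (dualObjL U).continuous.continuousOn
  have hexp : IsExposed ℝ K ((dualObjL U).toExposed K) := ContinuousLinearMap.toExposed.isExposed
  obtain ⟨D, hD⟩ := (hexp.isCompact hcomp).extremePoints_nonempty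
    (⟨D₂, hD₂, fun y hy => hmax hy⟩ : ((dualObjL U).toExposed K).Nonempty)
  refine ⟨D, hexp.isExtreme.extremePoints_subset_extremePoints hD, ?_⟩
  exact hobj.trans_le ((extremePoints_subset hD).2 _ hD₁)

theorem exists_solvesMaster (M' : ℝ) (w : S.Work) : ∃ w', SolvesMaster M' w w' := by
  by_cases h : ∃ x, S.IsRMPFeasible w.cols w.cuts x
  · obtain ⟨x, hx⟩ := exists_isRMPOptimal h
    obtain ⟨D, hD⟩ := exists_isDualOptimal hx
    exact ⟨_, .optimal x D hx hD⟩
  · push Not at h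
    obtain ⟨D, hD⟩ := exists_isNormalizedExtremeRay h
    exact ⟨_, .infeasible D h hD⟩

/-! ### Finiteness of extreme rays and of cuts -/

/-- The sign `1` or `-1` of a truth value. -/
def boolSign (b : Bool) : ℝ := if b then 1 else -1

theorem boolSign_mul_le_abs (b : Bool) (a : ℝ) : boolSign b * a ≤ |a| := by
  cases b
  · simpa [boolSign] using neg_le_abs a
  · simpa [boolSign] using le_abs_self a

theorem boolSign_mul_eq_abs (a : ℝ) : boolSign (decide (0 ≤ a)) * a = |a| := by
  by_cases h : 0 ≤ a
  · simp [boolSign, h, abs_of_nonneg]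
  · simp [boolSign, h, abs_of_neg (not_le.1 h)]

/-- The 1-norm is the maximum of finitely many signed sums, so the section of the dual cone by the
unit ball is a polyhedron inside the subspace `L` of vectors that vanish off `U`. -/
theorem finite_setOf_isNormalizedExtremeRay (C : S.Columns) (U : Finset S.Cut) :
    {D | IsNormalizedExtremeRay C U D}.Finite := by
  let σ := (S.Fire → Bool) × (S.Crew → Bool) × (S.Fire → S.Time → Bool) × (U → Bool)
  let sg : σ → S.Dual →ₗ[ℝ] ℝ := fun s =>
    { toFun := fun D => (∑ g, boolSign (s.1 g) * D.1 g) + (∑ j, boolSign (s.2.1 j) * D.2.1 j) +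
        (∑ g, ∑ t, boolSign (s.2.2.1 g t) * D.2.2.1 g t) +
        ∑ u : U, boolSign (s.2.2.2 u) * D.2.2.2 u
      map_add' := fun D D' => by
        simp only [Prod.fst_add, Prod.snd_add, Pi.add_apply, mul_add, Finset.sum_add_distrib]
        ring
      map_smul' := fun a D => by
        simp only [Prod.smul_fst, Prod.smul_snd, Pi.smul_apply, smul_eq_mul, mul_left_comm _ a,
          ← Finset.mul_sum, mul_add, RingHom.id_apply] }
  let ι := (Σ g, S.Plan g) ⊕ (Σ j, S.Route j) ⊕ (S.Fire × S.Time) ⊕ U ⊕ σ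
  let f : ι → S.Dual →ₗ[ℝ] ℝ := fun i => match i with
    | .inl a => if a.2 ∈ C.Q a.1 then planValueₗ U a.1 a.2 else 0
    | .inr (.inl a) => if a.2 ∈ C.P a.1 then routeValueₗ U a.1 a.2 else 0
    | .inr (.inr (.inl a)) => - linkPriceₗ a.1 a.2
    | .inr (.inr (.inr (.inl u))) => - cutPriceₗ u.1
    | .inr (.inr (.inr (.inr s))) => sg s
  let b : ι → ℝ := fun i => match i with
    | .inr (.inr (.inr (.inr _))) => 1
    | _ => 0
  let L : Submodule ℝ S.Dual :=
    { carrier := {D | ∀ u ∉ U, D.2.2.2 u = 0}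
      add_mem' := fun {D D'} h h' u hu => by
        show D.2.2.2 u + D'.2.2.2 u = 0
        rw [h u hu, h' u hu, add_zero]
      zero_mem' := fun u _ => rfl
      smul_mem' := fun a D h u hu => by
        show a * D.2.2.2 u = 0
        rw [h u hu, mul_zero] }
  have hset : {D : S.Dual | D ∈ dualCone C U ∧ dualNorm U D ≤ 1} = {D | D ∈ L ∧ ∀ i, f i D ≤ b i} := by
    ext D
    simp only [Set.mem_ofPred_eq]
    constructor
    · rintro ⟨⟨h1, h2, h3⟩, hn⟩
      refine ⟨h1.α_supp, ?_⟩
      rintro (a | a | a | u | s)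
      · by_cases ha : a.2 ∈ C.Q a.1
        · simpa [f, b, ha] using h2 a.1 a.2 ha
        · simp [f, b, ha]
      · by_cases ha : a.2 ∈ C.P a.1
        · simpa [f, b, ha] using h3 a.1 a.2 ha
        · simp [f, b, ha]
      · simpa [f, b] using h1.ρ_nonneg a.1 a.2
      · simpa [f, b] using h1.α_nonneg u.1 u.2
      · refine le_trans ?_ hn
        show (∑ g, boolSign (s.1 g) * D.1 g) + (∑ j, boolSign (s.2.1 j) * D.2.1 j) +
          (∑ g, ∑ t, boolSign (s.2.2.1 g t) * D.2.2.1 g t) +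
          ∑ u : U, boolSign (s.2.2.2 u) * D.2.2.2 u ≤ _
        unfold dualNorm
        rw [← Finset.sum_coe_sort U]
        gcongr <;> exact boolSign_mul_le_abs _ _
    · rintro ⟨hL, h⟩
      refine ⟨⟨⟨fun g t => ?_, fun u hu => ?_, hL⟩, fun g q hq => ?_, fun j p hp => ?_⟩, ?_⟩
      · simpa [f, b] using h (.inr (.inr (.inl (g, t))))
      · simpa [f, b] using h (.inr (.inr (.inr (.inl ⟨u, hu⟩))))
      · simpa [f, b, hq] using h (.inl ⟨g, q⟩)
      · simpa [f, b, hp] using h (.inr (.inl ⟨j, p⟩))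
      · have := h (.inr (.inr (.inr (.inr (fun g => decide (0 ≤ D.1 g), fun j => decide (0 ≤ D.2.1 j),
          fun g t => decide (0 ≤ D.2.2.1 g t), fun u => decide (0 ≤ D.2.2.2 u))))))
        simp only [f, b, sg, LinearMap.coe_mk, AddHom.coe_mk, boolSign_mul_eq_abs] at this
        unfold dualNorm
        rwa [← Finset.sum_coe_sort U]
  refine (finite_extremePoints_of_polyhedron L f b).subset fun D hD => ?_
  rw [← hset]
  exact hD.1

/-- The cuts that the algorithm may generate. -/
def validCuts (S : SetPartitioning.{u}) : Set S.Cut := {u | S.IsGUBCover u ∨ S.IsAugmentedGUB u}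

theorem finite_extremePoints_cglp (Gu : Finset S.Fire) (Ju : Finset S.Crew) :
    (Set.extremePoints ℝ (S.cglp Gu Ju)).Finite := by
  let Δ := S.Fire → Fin (S.numCrews + 1) → ℝ
  let ev : S.Fire → Fin (S.numCrews + 1) → Δ × ℝ →ₗ[ℝ] ℝ := fun g d =>
    LinearMap.proj d ∘ₗ LinearMap.proj g ∘ₗ LinearMap.fst ℝ Δ ℝ
  let ι := (Gu × Fin (S.numCrews + 1)) ⊕ (Gu × Fin (S.numCrews + 1)) ⊕ S.demandSets Gu Ju
  let f : ι → Δ × ℝ →ₗ[ℝ] ℝ := fun i => match i with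
    | .inl a => - ev a.1 a.2
    | .inr (.inl a) => ev a.1 a.2
    | .inr (.inr H) => ∑ a ∈ H.1, ev a.1 a.2 - LinearMap.snd ℝ Δ ℝ
  let b : ι → ℝ := fun i => match i with
    | .inr (.inl _) => 1
    | _ => 0
  let L : Submodule ℝ (Δ × ℝ) :=
    { carrier := {w | ∀ g ∉ Gu, ∀ d, w.1 g d = 0}
      add_mem' := fun {D D'} h h' u hu d => by
        show D.1 u d + D'.1 u d = 0
        rw [h u hu, h' u hu, add_zero]
      zero_mem' := fun u _ _ => rfl
      smul_mem' := fun a D h u hu d => by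
        show a * D.1 u d = 0
        rw [h u hu, mul_zero] }
  have hset : S.cglp Gu Ju = {w | w ∈ L ∧ ∀ i, f i w ≤ b i} := by
    ext w
    constructor
    · rintro ⟨h1, h2, h3⟩
      refine ⟨h2, ?_⟩
      rintro (a | a | H)
      · simpa [f, b, ev] using (h1 a.1 a.1.2 a.2).1
      · simpa [f, b, ev] using (h1 a.1 a.1.2 a.2).2
      · simpa [f, b, ev] using h3 H.1 H.2
    · rintro ⟨h2, h⟩
      refine ⟨fun g hg d => ⟨?_, ?_⟩, h2, fun H hH => ?_⟩
      · simpa [f, b, ev] using h (.inl (⟨g, hg⟩, d))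
      · simpa [f, b, ev] using h (.inr (.inl (⟨g, hg⟩, d)))
      · simpa [f, b, ev] using h (.inr (.inr ⟨H, hH⟩))
  rw [hset]
  exact finite_extremePoints_of_polyhedron L f b

/-- A period, a set of fires and a set of crews leave finitely many target vectors for a cover cut,
and finitely many extreme points for an augmented one. Without extremality there could be infinitely
many cuts, and neither termination nor a uniform `M'` would follow. -/
theorem finite_validCuts (S : SetPartitioning.{u}) : S.validCuts.Finite := by
  have h1 : {u | S.IsGUBCover u}.Finite := by
    refine (Set.finite_range fun a : S.Time × Finset S.Fire × Finset S.Crew ×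
      (S.Fire → Fin (S.numCrews + 1)) => (⟨a.1, a.2.1, a.2.2.1,
        fun g d => if g ∈ a.2.1 ∧ a.2.2.2 g ≤ d then 1 else 0, (a.2.1.card : ℝ) - 1⟩ : S.Cut)).subset ?_
    rintro ⟨t, Gu, Ju, δ, K⟩ ⟨D, -, h2, h3⟩
    exact ⟨(t, Gu, Ju, D), by rw [show δ = _ from h2, show K = _ from h3]⟩
  have h2 : {u | S.IsAugmentedGUB u}.Finite := by
    refine (Set.finite_iUnion fun a : S.Time × Finset S.Fire × Finset S.Crew =>
      (finite_extremePoints_cglp a.2.1 a.2.2).image fun w =>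
        (⟨a.1, a.2.1, a.2.2, w.1, w.2⟩ : S.Cut)).subset ?_
    rintro ⟨t, Gu, Ju, δ, K⟩ hu
    exact Set.mem_iUnion.2 ⟨(t, Gu, Ju), (δ, K), hu, rfl⟩
  exact h1.union h2

/-! ### Structural assumptions on the set partitioning problem. -/

/-- The properties of the wildfire problem on which the algorithm relies. -/
structure Regular (S : SetPartitioning.{u}) : Prop where
  planCost_nonneg : ∀ g q, 0 ≤ S.planCost g q
  routeCost_nonneg : ∀ j p, 0 ≤ S.routeCost j p
  sum_A_le_one : ∀ j p t, ∑ g, S.A j p g t ≤ 1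
  B_le_numCrews : ∀ g q t, S.B g q t ≤ S.numCrews

theorem Regular.A_le_one (hS : S.Regular) (j : S.Crew) (p : S.Route j) (g : S.Fire) (t : S.Time) :
    S.A j p g t ≤ 1 :=
  (Finset.single_le_sum (f := fun g => S.A j p g t) (fun _ _ => Nat.zero_le _)
    (Finset.mem_univ g)).trans (hS.sum_A_le_one j p t)

/-! ### Integer solutions -/

/-- The integer vector that selects one plan for each fire and one route for each crew. -/
def Sol.ofSelection (q : ∀ g, S.Plan g) (p : ∀ j, S.Route j) : S.Sol :=
  ⟨fun g r => if r = q g then 1 else 0, fun j r => if r = p j then 1 else 0⟩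

theorem exists_eq_ite_of_sum_eq_one {α : Type*} [Fintype α] {y : α → ℝ}
    (h1 : ∑ a, y a = 1) (h : ∀ a, y a = 0 ∨ y a = 1) : ∃ a, y = fun r => if r = a then 1 else 0 := by
  obtain ⟨a, ha⟩ : ∃ a, y a ≠ 0 := by
    by_contra hn
    push Not at hn
    simp [hn] at h1
  have ha1 : y a = 1 := (h a).resolve_left ha
  refine ⟨a, funext fun r => ?_⟩
  by_cases hr : r = a
  · rw [if_pos hr, hr, ha1]
  · rw [if_neg hr]
    have hnn : ∀ b, 0 ≤ y b := fun b => by rcases h b with e | e <;> rw [e]; exact zero_le_one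
    have := Finset.add_sum_erase Finset.univ y (Finset.mem_univ a)
    rw [h1, ha1] at this
    exact (Finset.sum_eq_zero_iff_of_nonneg fun b _ => hnn b).1 (by linarith) r
      (Finset.mem_erase.2 ⟨hr, Finset.mem_univ _⟩)

theorem IsFeasible.exists_eq_ofSelection {x : S.Sol} (hx : S.IsFeasible x) :
    ∃ q p, x = Sol.ofSelection q p := by
  choose q hq using fun g => exists_eq_ite_of_sum_eq_one (hx.plan g) (hx.y_binary g)
  choose p hp using fun j => exists_eq_ite_of_sum_eq_one (hx.route j) (hx.z_binary j)
  exact ⟨q, p, Sol.ext (funext hq) (funext hp)⟩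

theorem lhs_ofSelection (u : S.Cut) (q : ∀ g, S.Plan g) (p : ∀ j, S.Route j) :
    u.lhs (Sol.ofSelection q p) = (∑ g, u.planCoef g (q g)) + ∑ j, u.routeCoef j (p j) := by
  simp [Cut.lhs, Sol.ofSelection]

theorem isFeasible_ofSelection {q : ∀ g, S.Plan g} {p : ∀ j, S.Route j} :
    S.IsFeasible (Sol.ofSelection q p) ↔ ∀ g t, S.B g (q g) t ≤ ∑ j, S.A j (p j) g t := by
  have hlink : ∀ g t, (0 ≤ (∑ j, ∑ r, (S.A j r g t : ℝ) * (Sol.ofSelection q p).z j r) -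
      ∑ r, (S.B g r t : ℝ) * (Sol.ofSelection q p).y g r) ↔
      S.B g (q g) t ≤ ∑ j, S.A j (p j) g t := fun g t => by
    simp only [Sol.ofSelection, mul_ite, mul_one, mul_zero, Finset.sum_ite_eq', Finset.mem_univ,
      if_true, sub_nonneg]
    exact_mod_cast Iff.rfl
  constructor
  · exact fun h g t => (hlink g t).1 (h.link g t)
  · intro h
    refine ⟨fun g => by simp [Sol.ofSelection], fun j => by simp [Sol.ofSelection],
      fun g t => (hlink g t).2 (h g t), fun j r => ?_, fun g r => ?_⟩
    · by_cases e : r = p j <;> simp [Sol.ofSelection, e]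
    · by_cases e : r = q g <;> simp [Sol.ofSelection, e]

/-! ### Validity of the cuts -/

/-- If a demand set reached the target of every fire, its total would be at least `∑ D_g`, which
exceeds the number of crews available outside `u.crews`. So at least one fire misses its target.
This lets both families of cuts be treated through the constraints of the cut generating program. -/
theorem IsGUBCover.mem_cglp {u : S.Cut} (h : S.IsGUBCover u) :
    (u.δ, u.K) ∈ S.cglp u.fires u.crews := by
  obtain ⟨D, hD, hδ, hK⟩ := h
  refine ⟨fun g hg d => ?_, fun g hg d => ?_, fun H hH => ?_⟩
  · simp only [hδ]; split_ifs <;> simp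
  · simp [hδ, hg]
  · obtain ⟨h1, h2, h3⟩ := hH
    simp only [hδ, hK, Finset.sum_ite, Finset.sum_const_zero, add_zero, Finset.sum_const,
      nsmul_eq_mul, mul_one]
    set H' := H.filter fun a => a.1 ∈ u.fires ∧ D a.1 ≤ a.2 with hH'
    have hinj : Set.InjOn Prod.fst (H' : Set (S.Fire × Fin (S.numCrews + 1))) := by
      intro a ha b hb hab
      rw [Finset.mem_coe, hH', Finset.mem_filter] at ha hb
      exact Finset.card_le_one.1 (h3 a.1 ha.2.1) a (Finset.mem_filter.2 ⟨ha.1, rfl⟩) b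
        (Finset.mem_filter.2 ⟨hb.1, hab.symm⟩)
    have hsub : H'.image Prod.fst ⊆ u.fires := by
      intro g hg
      obtain ⟨a, ha, rfl⟩ := Finset.mem_image.1 hg
      exact (Finset.mem_filter.1 ha).2.1
    have hlt : H'.card < u.fires.card := by
      rw [← Finset.card_image_of_injOn hinj]
      refine lt_of_le_of_ne (Finset.card_le_card hsub) fun e => ?_
      have heq := Finset.eq_of_subset_of_card_le hsub e.ge
      have : ∑ g ∈ u.fires, (D g : ℕ) ≤ ∑ a ∈ H, (a.2 : ℕ) := by
        rw [← heq, Finset.sum_image hinj]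
        calc ∑ a ∈ H', (D a.1 : ℕ) ≤ ∑ a ∈ H', (a.2 : ℕ) :=
              Finset.sum_le_sum fun a ha => (Finset.mem_filter.1 ha).2.2
          _ ≤ _ := Finset.sum_le_sum_of_subset (Finset.filter_subset _ _)
      omega
    have : ((H'.card + 1 : ℕ) : ℝ) ≤ u.fires.card := Nat.cast_le.2 hlt
    push_cast at this
    linarith

theorem mem_cglp_of_mem_validCuts {u : S.Cut} (h : u ∈ S.validCuts) :
    (u.δ, u.K) ∈ S.cglp u.fires u.crews :=
  h.elim IsGUBCover.mem_cglp fun h => extremePoints_subset h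

/-- Let `n` crews of `u.crews` work at fires of the cut. The crew part of the left-hand side is then
`|crews| - n`. Dropping at most `n` fires leaves demands that the remaining crews can meet, hence a
demand set, of weight at most `K`. Each dropped fire weighs at most 1, so the `n` cancels. -/
theorem lhs_le_rhs_of_isFeasible (hS : S.Regular) {u : S.Cut} (hu : u ∈ S.validCuts) {x : S.Sol}
    (hx : S.IsFeasible x) : u.lhs x ≤ u.rhs := by
  obtain ⟨q, p, rfl⟩ := hx.exists_eq_ofSelection
  rw [isFeasible_ofSelection] at hx
  obtain ⟨h1, -, h3⟩ := mem_cglp_of_mem_validCuts hu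
  let b : S.Fire → Fin (S.numCrews + 1) := fun g =>
    ⟨S.B g (q g) u.t, Nat.lt_succ_of_le (hS.B_le_numCrews g (q g) u.t)⟩
  have hplan : ∑ g, u.planCoef g (q g) = ∑ g ∈ u.fires, u.δ g (b g) := by
    simp only [Cut.planCoef, Finset.sum_ite_mem, Finset.univ_inter]
    refine Finset.sum_congr rfl fun g _ => ?_
    rw [Finset.sum_eq_single (b g) (fun d _ hd => if_neg fun e => hd (Fin.ext e.symm)) (by simp)]
    simp [b]
  set n := (u.crews.filter fun j => ∑ g ∈ u.fires, S.A j (p j) g u.t ≠ 0).card with hn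
  have hroute : ∑ j, u.routeCoef j (p j) + n = u.crews.card := by
    have h := Finset.card_filter_add_card_filter_not (s := u.crews)
      (fun j => ∑ g ∈ u.fires, S.A j (p j) g u.t = 0)
    have : ∑ j, u.routeCoef j (p j) =
        (u.crews.filter fun j => ∑ g ∈ u.fires, S.A j (p j) g u.t = 0).card := by
      simp only [Cut.routeCoef, ite_and, Finset.sum_ite_mem, Finset.univ_inter, Finset.sum_boole]
    rw [this, hn]
    exact_mod_cast h
  have hA : ∀ j, ∑ g ∈ u.fires, S.A j (p j) g u.t ≤ 1 := fun j =>
    (Finset.sum_le_sum_of_subset (Finset.subset_univ _)).trans (hS.sum_A_le_one j (p j) u.t)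
  -- Each crew serves at most one fire in a period: crews outside the cut contribute at most
  -- `numCrews - |crews|` in total, those inside at most `n`.
  have hdemand : ∑ g ∈ u.fires, S.B g (q g) u.t ≤ (S.numCrews - u.crews.card) + n := by
    calc ∑ g ∈ u.fires, S.B g (q g) u.t ≤ ∑ g ∈ u.fires, ∑ j, S.A j (p j) g u.t :=
          Finset.sum_le_sum fun g _ => hx g u.t
      _ = ∑ j, ∑ g ∈ u.fires, S.A j (p j) g u.t := Finset.sum_comm
      _ = ∑ j ∈ u.crewsᶜ, ∑ g ∈ u.fires, S.A j (p j) g u.t +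
          ∑ j ∈ u.crews, ∑ g ∈ u.fires, S.A j (p j) g u.t :=
          (Finset.sum_compl_add_sum _ _).symm
      _ ≤ ∑ j ∈ u.crewsᶜ, 1 + ∑ j ∈ u.crews,
          (if ∑ g ∈ u.fires, S.A j (p j) g u.t ≠ 0 then 1 else 0) := by
          refine add_le_add (Finset.sum_le_sum fun j _ => hA j) (Finset.sum_le_sum fun j _ => ?_)
          split_ifs with h
          · exact hA j
          · exact (not_not.1 h).le
      _ = _ := by
          rw [Finset.sum_const, smul_eq_mul, mul_one, Finset.card_compl, Finset.sum_boole]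
          rfl
  obtain ⟨R, hR, hRn, hRm⟩ := exists_card_le_sum_sdiff_le _ _ _ _ hdemand
  have hinj : Function.Injective fun g => (g, b g) := fun g g' e => (Prod.ext_iff.1 e).1
  have hJ : u.crews.card ≤ S.numCrews := Finset.card_le_univ _
  have hH : (u.fires \ R).image (fun g => (g, b g)) ∈ S.demandSets u.fires u.crews := by
    refine ⟨fun a ha => ?_, ?_, fun g _ => ?_⟩
    · obtain ⟨g, hg, rfl⟩ := Finset.mem_image.1 ha
      exact (Finset.mem_sdiff.1 hg).1
    · rw [Finset.sum_image hinj.injOn]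
      have : ∑ g ∈ u.fires \ R, (b g : ℕ) ≤ S.numCrews - u.crews.card := hRm
      show ∑ g ∈ u.fires \ R, (b g : ℕ) + u.crews.card ≤ S.numCrews
      omega
    · refine Finset.card_le_one.2 fun a ha c hc => ?_
      simp only [Finset.mem_filter, Finset.mem_image] at ha hc
      obtain ⟨⟨a', -, rfl⟩, rfl⟩ := ha
      obtain ⟨⟨c', -, rfl⟩, e⟩ := hc
      simp only at e
      rw [e]
  have hK := h3 _ hH
  rw [Finset.sum_image hinj.injOn] at hK
  have hsplit := Finset.sum_sdiff (f := fun g => u.δ g (b g)) hR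
  have hR1 : ∑ g ∈ R, u.δ g (b g) ≤ R.card := by
    have := Finset.sum_le_card_nsmul R (fun g => u.δ g (b g)) 1 fun g hg => (h1 g (hR hg) (b g)).2
    simpa using this
  have hRn' : (R.card : ℝ) ≤ n := Nat.cast_le.2 hRn
  rw [lhs_ofSelection, hplan, Cut.rhs]
  simp only at hK
  linarith

/-! ### Variances -/

theorem variance_eq_sum {α : Type*} [Fintype α] {y : α → ℝ} (h1 : ∑ a, y a = 1) (b : α → ℝ) :
    (∑ a, b a ^ 2 * y a) - (∑ a, b a * y a) ^ 2 = ∑ a, y a * (b a - ∑ c, b c * y c) ^ 2 := by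
  set m := ∑ c, b c * y c with hm
  have : ∀ a, y a * (b a - m) ^ 2 = b a ^ 2 * y a - 2 * m * (b a * y a) + m ^ 2 * y a :=
    fun a => by ring
  simp only [this, Finset.sum_add_distrib, Finset.sum_sub_distrib, ← Finset.mul_sum, ← hm, h1]
  ring

theorem variance_nonneg {α : Type*} [Fintype α] {y : α → ℝ} (h0 : ∀ a, 0 ≤ y a)
    (h1 : ∑ a, y a = 1) (b : α → ℝ) : 0 ≤ (∑ a, b a ^ 2 * y a) - (∑ a, b a * y a) ^ 2 := by
  rw [variance_eq_sum h1]
  exact Finset.sum_nonneg fun a _ => mul_nonneg (h0 a) (sq_nonneg _)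

theorem eq_mean_of_variance_eq_zero {α : Type*} [Fintype α] {y : α → ℝ} (h0 : ∀ a, 0 ≤ y a)
    (h1 : ∑ a, y a = 1) {b : α → ℝ} (hv : (∑ a, b a ^ 2 * y a) - (∑ a, b a * y a) ^ 2 = 0)
    {a : α} (ha : y a ≠ 0) : b a = ∑ c, b c * y c := by
  rw [variance_eq_sum h1] at hv
  have := (Finset.sum_eq_zero_iff_of_nonneg fun a _ => mul_nonneg (h0 a) (sq_nonneg _)).1 hv a
    (Finset.mem_univ a)
  have := (mul_eq_zero.1 this).resolve_left ha
  linarith [pow_eq_zero_iff (two_ne_zero) |>.1 this]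

/-- If no value on the support were below the mean, all deviations would be nonnegative; they
average to zero, so they would vanish, and the variance with them. -/
theorem exists_lt_mean_of_variance_ne_zero {α : Type*} [Fintype α] {y : α → ℝ} (h0 : ∀ a, 0 ≤ y a)
    (h1 : ∑ a, y a = 1) {b : α → ℝ} (hv : (∑ a, b a ^ 2 * y a) - (∑ a, b a * y a) ^ 2 ≠ 0) :
    ∃ a, y a ≠ 0 ∧ b a < ∑ c, b c * y c := by
  by_contra hn
  push Not at hn
  set m := ∑ c, b c * y c with hm
  have hsum : ∑ a, (b a - m) * y a = 0 := by
    simp only [sub_mul, Finset.sum_sub_distrib, ← Finset.mul_sum, h1, ← hm]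
    ring
  have hnn : ∀ a ∈ Finset.univ, 0 ≤ (b a - m) * y a := fun a _ => by
    by_cases h : y a = 0
    · simp [h]
    · exact mul_nonneg (sub_nonneg.2 (hn a h)) (h0 a)
  refine hv ?_
  rw [hm, variance_eq_sum h1]
  refine Finset.sum_eq_zero fun a _ => ?_
  have := (Finset.sum_eq_zero_iff_of_nonneg hnn).1 hsum a (Finset.mem_univ a)
  linear_combination (b a - m) * this

theorem exists_mean_lt_of_variance_ne_zero {α : Type*} [Fintype α] {y : α → ℝ} (h0 : ∀ a, 0 ≤ y a)
    (h1 : ∑ a, y a = 1) {b : α → ℝ} (hv : (∑ a, b a ^ 2 * y a) - (∑ a, b a * y a) ^ 2 ≠ 0) :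
    ∃ a, y a ≠ 0 ∧ ∑ c, b c * y c < b a := by
  obtain ⟨a, ha, h⟩ := exists_lt_mean_of_variance_ne_zero (b := fun a => - b a) h0 h1
    (by simpa using hv)
  refine ⟨a, ha, ?_⟩
  simp only [neg_mul, Finset.sum_neg_distrib] at h
  linarith

/-- Positive weights only rescale variances, so a vanishing variance vanishes for all weights, and a
largest weighted variance is positive unless all unweighted ones are zero. -/
theorem fireVar_eq (ω : S.Fire → S.Time → ℝ) (x : S.Sol) (g : S.Fire) (t : S.Time) :
    fireVar ω x g t = ω g t ^ 2 * fireVar (fun _ _ => 1) x g t := by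
  simp only [fireVar, mul_one, mul_sub, ← mul_pow, Finset.mul_sum]
  congr 1
  · exact Finset.sum_congr rfl fun q _ => by ring
  · congr 1; exact Finset.sum_congr rfl fun q _ => by ring

theorem crewVar_eq (ω : S.Fire → S.Time → ℝ) (x : S.Sol) (j : S.Crew) (g : S.Fire) (t : S.Time) :
    crewVar ω x j g t = ω g t ^ 2 * crewVar (fun _ _ => 1) x j g t := by
  simp only [crewVar, mul_one, mul_sub, ← mul_pow, Finset.mul_sum]
  congr 1
  · exact Finset.sum_congr rfl fun q _ => by ring
  · congr 1; exact Finset.sum_congr rfl fun q _ => by ring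

theorem fireVar_one_nonneg {x : S.Sol} (hx : S.IsLPFeasible x) (g : S.Fire) (t : S.Time) :
    0 ≤ fireVar (fun _ _ => 1) x g t := by
  simp only [fireVar, mul_one]
  exact variance_nonneg (hx.y_nonneg g) (hx.plan g) _

theorem crewVar_one_nonneg {x : S.Sol} (hx : S.IsLPFeasible x) (j : S.Crew) (g : S.Fire)
    (t : S.Time) : 0 ≤ crewVar (fun _ _ => 1) x j g t := by
  simp only [crewVar, mul_one]
  exact variance_nonneg (hx.z_nonneg j) (hx.route j) _

theorem pos_of_isMaxVariance {x : S.Sol} (hx : S.IsLPFeasible x) (h : ¬ ZeroVariance x)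
    {ω : S.Fire → S.Time → ℝ} (hω : ∀ g t, 0 < ω g t) {m : ℝ} (hm : IsMaxVariance ω x m) : 0 < m := by
  by_contra hn
  refine h ⟨fun g t => ?_, fun j g t => ?_⟩
  · have h1 := hm.1 g t
    rw [fireVar_eq] at h1
    have h2 := fireVar_one_nonneg hx g t
    have h3 := pow_pos (hω g t) 2
    by_contra h4
    have := mul_pos h3 (lt_of_le_of_ne h2 (Ne.symm h4))
    linarith
  · have h1 := hm.2 j g t
    rw [crewVar_eq] at h1
    have h2 := crewVar_one_nonneg hx j g t
    have h3 := pow_pos (hω g t) 2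
    by_contra h4
    have := mul_pos h3 (lt_of_le_of_ne h2 (Ne.symm h4))
    linarith

theorem exists_maxVarianceBranching {x : S.Sol} (h : ¬ ZeroVariance x) :
    ∃ a, MaxVarianceBranching (fun _ _ => 1) x a := by
  let F : (S.Fire × S.Time) ⊕ (S.Crew × S.Fire × S.Time) → ℝ
    | .inl a => fireVar (fun _ _ => 1) x a.1 a.2
    | .inr a => crewVar (fun _ _ => 1) x a.1 a.2.1 a.2.2
  have hne : Nonempty ((S.Fire × S.Time) ⊕ (S.Crew × S.Fire × S.Time)) := by
    by_contra hn
    rw [not_nonempty_iff] at hn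
    exact h ⟨fun g t => (hn.false (.inl (g, t))).elim, fun j g t => (hn.false (.inr (j, g, t))).elim⟩
  obtain ⟨i, hi⟩ := Finite.exists_max F
  have hmax : IsMaxVariance (fun _ _ => 1) x (F i) :=
    ⟨fun g t => hi (.inl (g, t)), fun j g t => hi (.inr (j, g, t))⟩
  rcases i with ⟨g, t⟩ | ⟨j, g, t⟩
  · exact ⟨_, .fire g t hmax⟩
  · exact ⟨_, .crew j g t hmax⟩

/-! ### Conversion of a solution of variance zero -/

theorem sum_mul_eq_of_const {α : Type*} [Fintype α] {y : α → ℝ} (h1 : ∑ a, y a = 1) {F : α → ℝ}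
    {c : ℝ} (h : ∀ a, y a ≠ 0 → F a = c) : ∑ a, F a * y a = c := by
  have : ∀ a, F a * y a = c * y a := fun a => by
    by_cases ha : y a = 0
    · simp [ha]
    · rw [h a ha]
  simp only [this, ← Finset.mul_sum, h1, mul_one]

/-- Optimality of `x` is essential: one moves from `x` away from `x'`, to `x + ε (x - x')`, and this
move cannot lower the cost. -/
theorem isFeasible_and_cost_le_of_isIntegerSelection {C : S.Columns} {U : Finset S.Cut} {x x' : S.Sol}
    (hx : S.IsRMPOptimal C U x) (h0 : ZeroVariance x) (hx' : IsIntegerSelection x x') :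
    S.IsFeasible x' ∧ S.cost x' ≤ S.cost x := by
  obtain ⟨h1, h2⟩ := hx'
  choose q hq hyq using h1
  choose p hp hzp using h2
  obtain rfl : x' = Sol.ofSelection q p := Sol.ext (funext hyq) (funext hzp)
  have hlp := hx.1.lp
  have hB : ∀ g r t, x.y g r ≠ 0 → S.B g r t = S.B g (q g) t := fun g r t hr => by
    have hv := h0.1 g t
    simp only [fireVar, mul_one] at hv
    have e1 := eq_mean_of_variance_eq_zero (hlp.y_nonneg g) (hlp.plan g) hv hr
    have e2 := eq_mean_of_variance_eq_zero (hlp.y_nonneg g) (hlp.plan g) hv (hq g).ne'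
    exact_mod_cast e1.trans e2.symm
  have hA : ∀ j r g t, x.z j r ≠ 0 → S.A j r g t = S.A j (p j) g t := fun j r g t hr => by
    have hv := h0.2 j g t
    simp only [crewVar, mul_one] at hv
    have e1 := eq_mean_of_variance_eq_zero (hlp.z_nonneg j) (hlp.route j) hv hr
    have e2 := eq_mean_of_variance_eq_zero (hlp.z_nonneg j) (hlp.route j) hv (hp j).ne'
    exact_mod_cast e1.trans e2.symm
  have hBx : ∀ g t, ∑ r, (S.B g r t : ℝ) * x.y g r = S.B g (q g) t := fun g t =>
    sum_mul_eq_of_const (hlp.plan g) fun r hr => by rw [hB g r t hr]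
  have hAx : ∀ j g t, ∑ r, (S.A j r g t : ℝ) * x.z j r = S.A j (p j) g t := fun j g t =>
    sum_mul_eq_of_const (hlp.route j) fun r hr => by rw [hA j r g t hr]
  have hfeas : S.IsFeasible (Sol.ofSelection q p) := by
    rw [isFeasible_ofSelection]
    intro g t
    have := hlp.link g t
    simp only [hBx, hAx, sub_nonneg] at this
    exact_mod_cast this
  refine ⟨hfeas, ?_⟩
  -- Cut coefficients depend on a column only through its demands or assignments, which are constant
  -- on the support.
  have hlhs : ∀ u : S.Cut, u.lhs x = u.lhs (Sol.ofSelection q p) := fun u => by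
    rw [lhs_ofSelection, Cut.lhs]
    congr 1
    · exact Finset.sum_congr rfl fun g _ => sum_mul_eq_of_const (hlp.plan g) fun r hr => by
        simp only [Cut.planCoef, hB g r _ hr]
    · exact Finset.sum_congr rfl fun j _ => sum_mul_eq_of_const (hlp.route j) fun r hr => by
        simp only [Cut.routeCoef, hA j r _ _ hr]
  -- Small moves away from `x'` keep nonnegativity, since `x'` is positive only where `x` is.
  have hev : ∀ y y' : ℝ, 0 ≤ y → y' = 0 ∨ 0 < y → ∀ᶠ ε : ℝ in nhdsWithin 0 (Set.Ioi 0),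
      0 ≤ y + ε * (y - y') := by
    intro y y' hy hyy
    rcases hyy with rfl | hpos
    · filter_upwards [self_mem_nhdsWithin] with ε hε
      have : 0 < ε := hε
      rw [sub_zero]; positivity
    · have : Filter.Tendsto (fun ε : ℝ => y + ε * (y - y')) (nhdsWithin 0 (Set.Ioi 0))
          (nhds (y + 0 * (y - y'))) :=
        (Continuous.tendsto (by fun_prop) 0).mono_left nhdsWithin_le_nhds
      rw [zero_mul, add_zero] at this
      exact (this.eventually_const_lt hpos).mono fun _ h => h.le
  set x' := Sol.ofSelection q p with hx'def
  have hevy : ∀ᶠ ε : ℝ in nhdsWithin 0 (Set.Ioi 0), ∀ g r,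
      0 ≤ x.y g r + ε * (x.y g r - x'.y g r) :=
    Filter.eventually_all.2 fun g => Filter.eventually_all.2 fun r =>
      hev _ _ (hlp.y_nonneg g r) (by
        by_cases e : r = q g
        · right; rw [e]; exact hq g
        · left; simp [hx'def, Sol.ofSelection, e])
  have hevz : ∀ᶠ ε : ℝ in nhdsWithin 0 (Set.Ioi 0), ∀ j r,
      0 ≤ x.z j r + ε * (x.z j r - x'.z j r) :=
    Filter.eventually_all.2 fun j => Filter.eventually_all.2 fun r =>
      hev _ _ (hlp.z_nonneg j r) (by
        by_cases e : r = p j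
        · right; rw [e]; exact hp j
        · left; simp [hx'def, Sol.ofSelection, e])
  obtain ⟨ε, ⟨hεy, hεz⟩, hε⟩ := ((hevy.and hevz).and self_mem_nhdsWithin).exists
  have hε : 0 < ε := hε
  let x'' : S.Sol := ⟨fun g r => x.y g r + ε * (x.y g r - x'.y g r),
    fun j r => x.z j r + ε * (x.z j r - x'.z j r)⟩
  have hFy : ∀ g (F : S.Plan g → ℝ), ∑ r, F r * x''.y g r =
      (∑ r, F r * x.y g r) + ε * ((∑ r, F r * x.y g r) - ∑ r, F r * x'.y g r) := fun g F => by
    simp only [x'', mul_add, mul_sub, mul_left_comm _ ε, Finset.sum_add_distrib,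
      Finset.sum_sub_distrib, Finset.mul_sum]
  have hFz : ∀ j (F : S.Route j → ℝ), ∑ r, F r * x''.z j r =
      (∑ r, F r * x.z j r) + ε * ((∑ r, F r * x.z j r) - ∑ r, F r * x'.z j r) := fun g F => by
    simp only [x'', mul_add, mul_sub, mul_left_comm _ ε, Finset.sum_add_distrib,
      Finset.sum_sub_distrib, Finset.mul_sum]
  have hlin : ∀ (F : ∀ g, S.Plan g → ℝ) (G : ∀ j, S.Route j → ℝ),
      (∑ g, ∑ r, F g r * x''.y g r) + (∑ j, ∑ r, G j r * x''.z j r) =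
      ((∑ g, ∑ r, F g r * x.y g r) + (∑ j, ∑ r, G j r * x.z j r)) +
      ε * (((∑ g, ∑ r, F g r * x.y g r) + (∑ j, ∑ r, G j r * x.z j r)) -
        ((∑ g, ∑ r, F g r * x'.y g r) + (∑ j, ∑ r, G j r * x'.z j r))) := fun F G => by
    simp only [hFy, hFz, Finset.sum_add_distrib, ← Finset.mul_sum, Finset.sum_sub_distrib]
    ring
  have hx'' : S.IsRMPFeasible C U x'' := by
    refine ⟨⟨fun g => ?_, fun j => ?_, fun g t => ?_, hεz, hεy⟩, fun g r hr => ?_, fun j r hr => ?_,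
      fun u hu => ?_⟩
    · have := hFy g fun _ => 1
      simp only [one_mul, hlp.plan, hfeas.plan] at this
      rw [this]; ring
    · have := hFz j fun _ => 1
      simp only [one_mul, hlp.route, hfeas.route] at this
      rw [this]; ring
    · have e1 : ∑ r, (S.B g r t : ℝ) * x''.y g r = ∑ r, (S.B g r t : ℝ) * x.y g r := by
        rw [hFy, hBx]; simp [hx'def, Sol.ofSelection]
      have e2 : ∀ j, ∑ r, (S.A j r g t : ℝ) * x''.z j r = ∑ r, (S.A j r g t : ℝ) * x.z j r :=
        fun j => by rw [hFz, hAx]; simp [hx'def, Sol.ofSelection]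
      simp only [e1, e2]
      exact hlp.link g t
    · have h1 : x.y g r = 0 := hx.1.y_supp g r hr
      have h2 : r ≠ q g := fun e => (hq g).ne' (e ▸ h1)
      simp [x'', hx'def, Sol.ofSelection, h1, h2]
    · have h1 : x.z j r = 0 := hx.1.z_supp j r hr
      have h2 : r ≠ p j := fun e => (hp j).ne' (e ▸ h1)
      simp [x'', hx'def, Sol.ofSelection, h1, h2]
    · have : u.lhs x'' = u.lhs x + ε * (u.lhs x - u.lhs x') := hlin _ _
      rw [this, hlhs u, sub_self, mul_zero, add_zero, ← hlhs u]
      exact hx.1.cuts u hu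
  have hc : S.cost x'' = S.cost x + ε * (S.cost x - S.cost x') := by
    have := hlin S.planCost S.routeCost
    simp only [cost]
    rw [add_comm, this]
    ring
  have := hx.2 x'' hx''
  rw [hc] at this
  have h3 : 0 ≤ ε * (S.cost x - S.cost x') := by linarith
  linarith [nonneg_of_mul_nonneg_right h3 hε]

/-! ### The constant `M'` -/

/-- The initial dual vector of column generation. -/
def initDual (S : SetPartitioning.{u}) (M M' : ℝ) : S.Dual :=
  (fun _ => M', fun _ => 0, fun _ _ => M, fun _ => 0)

/-- `M'` is large enough for the initial prices and for the prices obtained from dual rays to detect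
all useful columns. -/
structure IsThreshold (S : SetPartitioning.{u}) (M M' : ℝ) : Prop where
  nonneg : 0 ≤ M'
  init : ∀ g q, S.planCost g q + ∑ t, (S.B g q t : ℝ) * M < M'
  plan : ∀ (C : S.Columns) (U : Finset S.Cut) D, (U : Set S.Cut) ⊆ S.validCuts →
    IsNormalizedExtremeRay C U D → ∀ g q, 0 < planValue U D g q →
      S.planCost g q < M' * planValue U D g q
  route : ∀ (C : S.Columns) (U : Finset S.Cut) D, (U : Set S.Cut) ⊆ S.validCuts →
    IsNormalizedExtremeRay C U D → ∀ j p, 0 < routeValue U D j p →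
      S.routeCost j p < M' * routeValue U D j p

/-- There are finitely many sets of columns and of valid cuts, and finitely many rays for each pair.
This is what makes `M'` independent of the node and of the run. -/
theorem finite_rays (S : SetPartitioning.{u}) :
    {a : Finset S.Cut × S.Dual | (a.1 : Set S.Cut) ⊆ S.validCuts ∧
      ∃ C, IsNormalizedExtremeRay C a.1 a.2}.Finite := by
  have hC : Finite S.Columns := by
    refine Finite.of_injective (fun C : S.Columns => (C.Q, C.P)) ?_
    rintro ⟨Q, P⟩ ⟨Q', P'⟩ e
    simp only [Prod.mk.injEq] at e
    rw [e.1, e.2]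
  have hU := (S.finite_validCuts.toFinset.powerset).finite_toSet
  refine (hU.biUnion fun U _ => Set.finite_iUnion fun C : S.Columns =>
    (finite_setOf_isNormalizedExtremeRay C U).image fun D => (U, D)).subset ?_
  rintro ⟨U, D⟩ ⟨hU', C, hD⟩
  refine Set.mem_biUnion (x := U) ?_ (Set.mem_iUnion.2 ⟨C, D, hD, rfl⟩)
  rw [Finset.mem_coe, Finset.mem_powerset]
  exact fun u hu => S.finite_validCuts.mem_toFinset.2 (hU' hu)

theorem eventually_lt_mul (c v : ℝ) : ∀ᶠ M' : ℝ in Filter.atTop, 0 < v → c < M' * v := by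
  by_cases hv : 0 < v
  · filter_upwards [Filter.eventually_gt_atTop (c / v)] with M' h _
    rwa [div_lt_iff₀ hv] at h
  · exact Filter.Eventually.of_forall fun _ h => absurd h hv

theorem eventually_isThreshold (S : SetPartitioning.{u}) (M : ℝ) :
    ∀ᶠ M' : ℝ in Filter.atTop, S.IsThreshold M M' := by
  have h1 : ∀ᶠ M' : ℝ in Filter.atTop, ∀ g q, S.planCost g q + ∑ t, (S.B g q t : ℝ) * M < M' :=
    Filter.eventually_all.2 fun g => Filter.eventually_all.2 fun q => Filter.eventually_gt_atTop _
  have h2 := (Filter.eventually_all_finite (l := Filter.atTop) S.finite_rays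
    (p := fun a (M' : ℝ) => ∀ g q, 0 < planValue a.1 a.2 g q →
      S.planCost g q < M' * planValue a.1 a.2 g q)).2 fun a _ =>
    Filter.eventually_all.2 fun g => Filter.eventually_all.2 fun q => eventually_lt_mul _ _
  have h3 := (Filter.eventually_all_finite (l := Filter.atTop) S.finite_rays
    (p := fun a (M' : ℝ) => ∀ j p, 0 < routeValue a.1 a.2 j p →
      S.routeCost j p < M' * routeValue a.1 a.2 j p)).2 fun a _ =>
    Filter.eventually_all.2 fun g => Filter.eventually_all.2 fun q => eventually_lt_mul _ _
  filter_upwards [h1, h2, h3, Filter.eventually_ge_atTop 0] with M' h1 h2 h3 h4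
  exact ⟨h4, h1, fun C U D hU hD => h2 (U, D) ⟨hU, C, hD⟩, fun C U D hU hD => h3 (U, D) ⟨hU, C, hD⟩⟩

/-! ### Invariants of the algorithm -/

/-- The columns of a node comply with its branching decisions, and its cuts are valid. -/
structure NodeOK (b : List S.Branch) (C : S.Columns) (U : Finset S.Cut) : Prop where
  plans : ∀ g, C.Q g ⊆ S.allowedPlans b g
  routes : ∀ j, C.P j ⊆ S.allowedRoutes b j
  cuts : (U : Set S.Cut) ⊆ S.validCuts

/-- All columns used by a solution comply with the branching decisions. -/
def Complies (b : List S.Branch) (x : S.Sol) : Prop :=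
  (∀ g q, x.y g q ≠ 0 → q ∈ S.allowedPlans b g) ∧ ∀ j p, x.z j p ≠ 0 → p ∈ S.allowedRoutes b j

/-- The origin of the dual prices during column generation. -/
inductive GeneratesFrom (M M' : ℝ) (w : S.Work) : Prop
  | initial (hs : w.sol = none) (hd : w.dual = S.initDual M M')
  | optimal (x : S.Sol) (hs : w.sol = some x) (hx : S.IsRMPOptimal w.cols w.cuts x)
      (hD : IsDualOptimal w.cols w.cuts w.dual)
  | infeasible (D : S.Dual) (hs : w.sol = none) (hD : IsNormalizedExtremeRay w.cols w.cuts D)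
      (hd : w.dual = M' • D)

/-- The result of column generation is a lower bound for the node. -/
structure Evaluated (w : S.Work) : Prop where
  optimal : ∀ x, w.sol = some x → S.IsRMPOptimal w.cols w.cuts x
  bound : ∀ x, S.IsFeasible x → Complies w.branch x → S.costOrTop w.sol ≤ S.costOrTop (some x)

theorem exists_y_ne_zero {x : S.Sol} (hx : S.IsFeasible x) (g : S.Fire) : ∃ q, x.y g q ≠ 0 := by
  by_contra hn
  push Not at hn
  have := hx.plan g
  simp [hn] at this

theorem SolvesFirePricing.reducedCost_nonneg {w : S.Work} {q : ∀ g, Option (S.Plan g)}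
    {p : ∀ j, Option (S.Route j)} (hq : SolvesFirePricing w q) (h : NonnegReducedCosts w q p)
    (g : S.Fire) (r : S.Plan g) (hr : r ∈ S.allowedPlans w.branch g) :
    0 ≤ planReducedCost w.cuts w.dual g r := by
  rcases hq g with ⟨-, h0⟩ | ⟨r₀, -, e, hmin⟩
  · simp [h0] at hr
  · exact (h.1 g r₀ e).trans (hmin r hr)

theorem SolvesCrewPricing.reducedCost_nonneg {w : S.Work} {q : ∀ g, Option (S.Plan g)}
    {p : ∀ j, Option (S.Route j)} (hp : SolvesCrewPricing w p) (h : NonnegReducedCosts w q p)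
    (j : S.Crew) (r : S.Route j) (hr : r ∈ S.allowedRoutes w.branch j) :
    0 ≤ routeReducedCost w.cuts w.dual j r := by
  rcases hp j with ⟨-, h0⟩ | ⟨r₀, -, e, hmin⟩
  · simp [h0] at hr
  · exact (h.2 j r₀ e).trans (hmin r hr)

/-- The reduced costs are nonnegative on all complying columns, generated or not, so weak duality
applies to every complying feasible solution. What it gives depends on the origin of the prices. -/
theorem evaluated_of_reducedCost_nonneg (hS : S.Regular) [Nonempty S.Fire] {M M' : ℝ}
    (hM : S.IsThreshold M M') {w : S.Work} (hw : NodeOK w.branch w.cols w.cuts)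
    (hg : GeneratesFrom M M' w)
    (hq : ∀ g, ∀ r ∈ S.allowedPlans w.branch g, 0 ≤ planReducedCost w.cuts w.dual g r)
    (hp : ∀ j, ∀ r ∈ S.allowedRoutes w.branch j, 0 ≤ routeReducedCost w.cuts w.dual j r) :
    Evaluated w := by
  have hcuts : ∀ x, S.IsFeasible x → ∀ u ∈ w.cuts, u.lhs x ≤ u.rhs := fun x hx u hu =>
    lhs_le_rhs_of_isFeasible hS (hw.cuts hu) hx
  rcases hg with ⟨hs, hd⟩ | ⟨x, hs, hx, hD⟩ | ⟨D, hs, hD, hd⟩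
  · refine ⟨fun x hx => (by rw [hs] at hx; cases hx), fun x hx hc => ?_⟩
    -- At the initial prices every plan has negative reduced cost, so stopping means that no fire
    -- has a complying plan. This is informative only if there is a fire.
    obtain ⟨g⟩ := ‹Nonempty S.Fire›
    obtain ⟨q, hqx⟩ := exists_y_ne_zero hx g
    have h1 := hq g q (hc.1 g q hqx)
    have h2 := hM.init g q
    rw [hd] at h1
    simp only [planReducedCost, planValue, initDual, mul_zero, Finset.sum_const_zero, sub_zero] at h1
    linarith
  · refine ⟨fun x' hx' => ?_, fun x' hx' hc => ?_⟩
    · rw [hs] at hx'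
      cases hx'
      exact hx
    · rw [hs]
      refine WithTop.coe_le_coe.2 ((cost_le_dualObj hx hD).trans
        (dualObj_le_sum_of_value_le hx'.isLPFeasible (hcuts x' hx') hD.1.signed _ _
          (fun g q h => ?_) fun j p h => ?_))
      · exact sub_nonneg.1 (hq g q (hc.1 g q h))
      · exact sub_nonneg.1 (hp j p (hc.2 j p h))
  · refine ⟨fun x hx => (by rw [hs] at hx; cases hx), fun x hx hc => ?_⟩
    have hcone := (extremePoints_subset hD.1).1
    -- A complying column of positive value under the ray would have negative reduced cost at the
    -- prices `M' • D`. So the ray certifies infeasibility over all complying columns, by weak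
    -- duality with zero costs.
    refine absurd (dualObj_le_sum_of_value_le hx.isLPFeasible (hcuts x hx) hcone.1
      (fun _ _ => 0) (fun _ _ => 0) (fun g q h => ?_) fun j p h => ?_) ?_
    · by_contra hpos
      have h1 := hq g q (hc.1 g q h)
      rw [planReducedCost, hd, planValue_smul] at h1
      linarith [hM.plan _ _ D hw.cuts hD g q (not_le.1 hpos)]
    · by_contra hpos
      have h1 := hp j p (hc.2 j p h)
      rw [routeReducedCost, hd, routeValue_smul] at h1
      linarith [hM.route _ _ D hw.cuts hD j p (not_le.1 hpos)]
    · simpa using hD.2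

/-- The branching decisions of the node that is being processed. -/
def Phase.branch? : S.Phase → Option (List S.Branch)
  | .columnGeneration w => some w.branch
  | .separation w => some w.branch
  | .evaluation w => some w.branch
  | _ => none

/-- The invariants of the data of the node that is being processed. -/
def PhaseOK (M M' : ℝ) : S.Phase → Prop
  | .columnGeneration w => NodeOK w.branch w.cols w.cuts ∧ GeneratesFrom M M' w
  | .separation w => NodeOK w.branch w.cols w.cuts ∧ Evaluated w
  | .evaluation w => NodeOK w.branch w.cols w.cuts ∧ Evaluated w
  | _ => True

/-- The invariants of the algorithm. -/
structure Invariant (M M' : ℝ) (s : S.State) : Prop where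
  nodes : ∀ i ∈ s.unexplored, NodeOK i.branch i.cols i.cuts
  incumbent : ∀ x, s.incumbent = some x → S.IsFeasible x
  phase : PhaseOK M M' s.phase
  returned : s.phase = .returned → s.unexplored = 0
  covered : ∀ x, S.IsFeasible x → S.costOrTop s.incumbent ≤ S.costOrTop (some x) ∨
    (∃ i ∈ s.unexplored, Complies i.branch x) ∨ ∃ b ∈ s.phase.branch?, Complies b x

theorem generatesFrom_initWork (M M' : ℝ) (b : List S.Branch) (C : S.Columns) (U : Finset S.Cut) :
    GeneratesFrom M M' (S.initWork M M' b C U) := .initial rfl rfl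

theorem complies_nil (x : S.Sol) : Complies [] x :=
  ⟨fun _ _ _ => by simp [allowedPlans], fun _ _ _ => by simp [allowedRoutes]⟩

theorem invariant_initState (M M' : ℝ) : Invariant M M' (S.initState M M') where
  nodes _ h := by simp [initState] at h
  incumbent _ h := by simp [initState] at h
  phase := ⟨⟨fun _ => Finset.empty_subset _, fun _ => Finset.empty_subset _, by simp [initWork]⟩,
    generatesFrom_initWork _ _ _ _ _⟩
  returned h := by simp [initState] at h
  covered x _ := Or.inr (Or.inr ⟨[], rfl, complies_nil x⟩)

theorem NodeOK.expand {w : S.Work} (hw : NodeOK w.branch w.cols w.cuts)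
    {q : ∀ g, Option (S.Plan g)} {p : ∀ j, Option (S.Route j)} (hq : SolvesFirePricing w q)
    (hp : SolvesCrewPricing w p) : NodeOK w.branch (expand w q p) w.cuts where
  plans g r hr := by
    simp only [SetPartitioning.expand, Finset.mem_union, Finset.mem_filter, Option.mem_toFinset] at hr
    rcases hr with hr | ⟨hr, -⟩
    · exact hw.plans g hr
    · rcases hq g with ⟨e, -⟩ | ⟨r₀, h, e, -⟩ <;> rw [e] at hr <;> cases hr
      exact h
  routes j r hr := by
    simp only [SetPartitioning.expand, Finset.mem_union, Finset.mem_filter, Option.mem_toFinset] at hr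
    rcases hr with hr | ⟨hr, -⟩
    · exact hw.routes j hr
    · rcases hp j with ⟨e, -⟩ | ⟨r₀, h, e, -⟩ <;> rw [e] at hr <;> cases hr
      exact h
  cuts := hw.cuts

theorem IsRMPFeasible.mono {C C' : S.Columns} {U : Finset S.Cut} {x : S.Sol}
    (hx : S.IsRMPFeasible C U x) (hQ : ∀ g, C.Q g ⊆ C'.Q g) (hP : ∀ j, C.P j ⊆ C'.P j) :
    S.IsRMPFeasible C' U x where
  lp := hx.lp
  y_supp g q hq := hx.y_supp g q fun h => hq (hQ g h)
  z_supp j p hp := hx.z_supp j p fun h => hp (hP j h)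
  cuts := hx.cuts

/-- A feasible restricted master stays feasible when columns are added. So an infeasible one means
that no solution has been stored, and `sol` is still `none`. -/
theorem generatesFrom_of_solvesMaster {M M' : ℝ} {w w' : S.Work} (hg : GeneratesFrom M M' w)
    {q : ∀ g, Option (S.Plan g)} {p : ∀ j, Option (S.Route j)}
    (h : SolvesMaster M' { w with cols := expand w q p } w') : GeneratesFrom M M' w' := by
  cases h with
  | optimal x D hx hD => exact .optimal x rfl hx hD
  | infeasible D hx hD =>
    refine .infeasible D ?_ hD rfl
    rcases hg with ⟨hs, -⟩ | ⟨x, hs, hx', -⟩ | ⟨-, hs, -, -⟩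
    · exact hs
    · exact absurd (hx'.1.mono (fun g => Finset.subset_union_left)
        fun j => Finset.subset_union_left) (hx x)
    · exact hs

theorem SolvesMaster.branch_eq {M' : ℝ} {w w' : S.Work} (h : SolvesMaster M' w w') :
    w'.branch = w.branch := by cases h <;> rfl

theorem SolvesMaster.cols_eq {M' : ℝ} {w w' : S.Work} (h : SolvesMaster M' w w') :
    w'.cols = w.cols := by cases h <;> rfl

theorem SolvesMaster.cuts_eq {M' : ℝ} {w w' : S.Work} (h : SolvesMaster M' w w') :
    w'.cuts = w.cuts := by cases h <;> rfl

theorem NodeOK.child {w : S.Work} (hw : NodeOK w.branch w.cols w.cuts) (a : S.Branch) :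
    NodeOK (child w a).branch (child w a).cols (child w a).cuts where
  plans _ := Finset.inter_subset_right
  routes _ := Finset.inter_subset_right
  cuts _ hu := hw.cuts (Finset.mem_filter.1 hu).1

theorem allowedPlans_cons (a : S.Branch) (b : List S.Branch) (g : S.Fire) :
    S.allowedPlans (a :: b) g = (S.allowedPlans b g).filter fun q => a.AllowsPlan g q := by
  ext q
  simp only [allowedPlans, Finset.mem_filter, Finset.mem_univ, true_and, List.forall_mem_cons]
  exact and_comm

theorem allowedRoutes_cons (a : S.Branch) (b : List S.Branch) (j : S.Crew) :
    S.allowedRoutes (a :: b) j = (S.allowedRoutes b j).filter fun p => a.AllowsRoute j p := by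
  ext q
  simp only [allowedRoutes, Finset.mem_filter, Finset.mem_univ, true_and, List.forall_mem_cons]
  exact and_comm

theorem complies_cons {a : S.Branch} {b : List S.Branch} {x : S.Sol} (h : Complies b x)
    (hy : ∀ g q, x.y g q ≠ 0 → a.AllowsPlan g q) (hz : ∀ j p, x.z j p ≠ 0 → a.AllowsRoute j p) :
    Complies (a :: b) x := by
  refine ⟨fun g q hq => ?_, fun j p hp => ?_⟩
  · rw [allowedPlans_cons, Finset.mem_filter]
    exact ⟨h.1 g q hq, hy g q hq⟩
  · rw [allowedRoutes_cons, Finset.mem_filter]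
    exact ⟨h.2 j p hp, hz j p hp⟩

/-- Branching does not lose integer solutions. -/
theorem MaxVarianceBranching.exists_complies {ω : S.Fire → S.Time → ℝ} {x : S.Sol}
    {a : Bool → S.Branch} (ha : MaxVarianceBranching ω x a) {b : List S.Branch} {x' : S.Sol}
    (hx' : S.IsFeasible x') (hc : Complies b x') : ∃ up, Complies (a up :: b) x' := by
  obtain ⟨q, p, rfl⟩ := hx'.exists_eq_ofSelection
  have hq : ∀ g r, (Sol.ofSelection q p).y g r ≠ 0 → r = q g := fun g r h => by
    by_contra e
    exact h (if_neg e)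
  have hp : ∀ g r, (Sol.ofSelection q p).z g r ≠ 0 → r = p g := fun g r h => by
    by_contra e
    exact h (if_neg e)
  cases ha with
  | fire g t h =>
    -- An integer solution uses a single plan per fire, and that plan decides the side.
    refine ⟨decide (⌊meanDemand x g t⌋₊ < S.B g (q g) t), complies_cons hc (fun g' r hr => ?_)
      fun j r _ => trivial⟩
    rintro rfl
    rw [hq _ r hr]
    simp
  | crew j g t h =>
    refine ⟨decide (S.A j (p j) g t = 1), complies_cons hc (fun j r _ => trivial) fun j' r hr => ?_⟩
    rintro rfl
    rw [hp _ r hr]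
    simp

/-- The delicate field is `covered`. A node is given up only by `integer` and `prune`, where the
bound in `Evaluated` shows that its complying solutions do not beat the resulting incumbent, and by
`branch`, where each of them passes to a child. -/
theorem invariant_step (hS : S.Regular) [Nonempty S.Fire] {M M' : ℝ} (hM : S.IsThreshold M M')
    {s s' : S.State} (hs : Invariant M M' s) (h : Step M M' s s') : Invariant M M' s' := by
  obtain ⟨h1, h2, h3, -, h5⟩ := hs
  cases h with
  | pricingStop N inc w q p hq hp h =>
    exact ⟨h1, h2, ⟨h3.1, evaluated_of_reducedCost_nonneg hS hM h3.1 h3.2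
      (hq.reducedCost_nonneg h) (hp.reducedCost_nonneg h)⟩, nofun, h5⟩
  | pricingExpand N inc w w' q p hq hp h hw =>
    refine ⟨h1, h2, ⟨?_, generatesFrom_of_solvesMaster h3.2 hw⟩, nofun, fun x hx => ?_⟩
    · rw [hw.branch_eq, hw.cols_eq, hw.cuts_eq]
      exact h3.1.expand hq hp
    · have := h5 x hx
      simp only [Phase.branch?] at this ⊢
      rwa [hw.branch_eq]
  | addCuts N inc w x V hx hV h =>
    refine ⟨h1, h2, ⟨⟨h3.1.plans, h3.1.routes, fun u hu => ?_⟩, generatesFrom_initWork _ _ _ _ _⟩,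
      nofun, h5⟩
    rcases Finset.mem_union.1 (Finset.mem_coe.1 hu) with hu | hu
    · exact h3.1.cuts hu
    · exact (h u hu).1
  | noCuts N inc w => exact ⟨h1, h2, h3, nofun, h5⟩
  | integer N inc w x x' hx hc h hx' =>
    obtain ⟨hf, hcost⟩ := isFeasible_and_cost_le_of_isIntegerSelection (h3.2.optimal x hx) h hx'
    have hle : S.costOrTop (some x') ≤ S.costOrTop w.sol := by
      rw [hx]; exact WithTop.coe_le_coe.2 hcost
    refine ⟨h1, fun y hy => by cases hy; exact hf, trivial, nofun, fun y hy => ?_⟩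
    rcases h5 y hy with h | h | ⟨b, hb, h⟩
    · exact Or.inl ((hle.trans hc.le).trans h)
    · exact Or.inr (Or.inl h)
    · cases hb
      exact Or.inl (hle.trans (h3.2.bound y hy h))
  | prune N inc w hc =>
    refine ⟨h1, h2, trivial, nofun, fun y hy => ?_⟩
    rcases h5 y hy with h | h | ⟨b, hb, h⟩
    · exact Or.inl h
    · exact Or.inr (Or.inl h)
    · cases hb
      exact Or.inl (hc.trans (h3.2.bound y hy h))
  | branch N inc w x ω a hx hc h hω ha =>
    refine ⟨fun i hi => ?_, h2, trivial, nofun, fun y hy => ?_⟩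
    · rcases Multiset.mem_cons.1 hi with rfl | hi
      · exact h3.1.child _
      · rcases Multiset.mem_cons.1 hi with rfl | hi
        · exact h3.1.child _
        · exact h1 i hi
    · rcases h5 y hy with h | ⟨i, hi, h⟩ | ⟨b, hb, h⟩
      · exact Or.inl h
      · exact Or.inr (Or.inl ⟨i, Multiset.mem_cons_of_mem (Multiset.mem_cons_of_mem hi), h⟩)
      · cases hb
        obtain ⟨up, hup⟩ := ha.exists_complies hy h
        refine Or.inr (Or.inl ⟨child w (a up), ?_, hup⟩)
        cases up <;> simp
  | heuristicSkip N inc => exact ⟨h1, h2, trivial, nofun, h5⟩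
  | heuristicImprove N inc x hx hc =>
    refine ⟨h1, fun y hy => by cases hy; exact hx, trivial, nofun, fun y hy => ?_⟩
    rcases h5 y hy with h | h
    · exact Or.inl (hc.le.trans h)
    · exact Or.inr h
  | select N inc i =>
    refine ⟨fun k hk => h1 k (Multiset.mem_cons_of_mem hk), h2,
      ⟨h1 i (Multiset.mem_cons_self _ _), generatesFrom_initWork _ _ _ _ _⟩, nofun, fun y hy => ?_⟩
    rcases h5 y hy with h | ⟨k, hk, h⟩ | ⟨b, hb, h⟩
    · exact Or.inl h
    · rcases Multiset.mem_cons.1 hk with rfl | hk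
      · exact Or.inr (Or.inr ⟨_, rfl, h⟩)
      · exact Or.inr (Or.inl ⟨k, hk, h⟩)
    · cases hb
  | finish inc => exact ⟨h1, h2, trivial, fun _ => rfl, h5⟩

theorem invariant_of_reachable (hS : S.Regular) [Nonempty S.Fire] {M M' : ℝ}
    (hM : S.IsThreshold M M') {s : S.State} (h : S.Reachable M M' s) : Invariant M M' s := by
  induction h with
  | refl => exact invariant_initState M M'
  | tail _ hstep ih => exact invariant_step hS hM ih hstep

/-! ### Optimality -/

theorem Invariant.isOptimal {M M' : ℝ} {s : S.State} (hs : Invariant M M' s)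
    (hr : s.phase = .returned) :
    (∀ x, s.incumbent = some x → S.IsOptimal x) ∧ (s.incumbent = none → ∀ x, ¬ S.IsFeasible x) := by
  have hle : ∀ x, S.IsFeasible x → S.costOrTop s.incumbent ≤ S.costOrTop (some x) := fun x hx => by
    have := hs.covered x hx
    simpa [hs.returned hr, hr, Phase.branch?] using this
  refine ⟨fun x hx => ⟨hs.incumbent x hx, fun x' hx' => ?_⟩, fun hn x hx => ?_⟩
  · have := hle x' hx'
    rw [hx] at this
    exact WithTop.coe_le_coe.1 this
  · have := hle x hx
    rw [hn] at this
    exact absurd this (not_le.2 (WithTop.coe_lt_top _))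

/-! ### Progress -/

theorem exists_solvesFirePricing (w : S.Work) : ∃ q, SolvesFirePricing w q := by
  have : ∀ g, ∃ q : Option (S.Plan g), (q = none ∧ S.allowedPlans w.branch g = ∅) ∨
      ∃ r ∈ S.allowedPlans w.branch g, q = some r ∧ ∀ r' ∈ S.allowedPlans w.branch g,
        planReducedCost w.cuts w.dual g r ≤ planReducedCost w.cuts w.dual g r' := fun g => by
    rcases (S.allowedPlans w.branch g).eq_empty_or_nonempty with h | h
    · exact ⟨none, Or.inl ⟨rfl, h⟩⟩
    · obtain ⟨r, hr, hmin⟩ := Finset.exists_min_image _ (planReducedCost w.cuts w.dual g) h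
      exact ⟨some r, Or.inr ⟨r, hr, rfl, hmin⟩⟩
  choose q hq using this
  exact ⟨q, hq⟩

theorem exists_solvesCrewPricing (w : S.Work) : ∃ p, SolvesCrewPricing w p := by
  have : ∀ j, ∃ p : Option (S.Route j), (p = none ∧ S.allowedRoutes w.branch j = ∅) ∨
      ∃ r ∈ S.allowedRoutes w.branch j, p = some r ∧ ∀ r' ∈ S.allowedRoutes w.branch j,
        routeReducedCost w.cuts w.dual j r ≤ routeReducedCost w.cuts w.dual j r' := fun j => by
    rcases (S.allowedRoutes w.branch j).eq_empty_or_nonempty with h | h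
    · exact ⟨none, Or.inl ⟨rfl, h⟩⟩
    · obtain ⟨r, hr, hmin⟩ := Finset.exists_min_image _ (routeReducedCost w.cuts w.dual j) h
      exact ⟨some r, Or.inr ⟨r, hr, rfl, hmin⟩⟩
  choose p hp using this
  exact ⟨p, hp⟩

theorem exists_pos_of_sum_eq_one {α : Type*} [Fintype α] {y : α → ℝ} (h1 : ∑ a, y a = 1) :
    ∃ a, 0 < y a := by
  by_contra hn
  push Not at hn
  linarith [Finset.sum_nonpos fun a (_ : a ∈ Finset.univ) => hn a]

theorem IsLPFeasible.exists_isIntegerSelection {x : S.Sol} (hx : S.IsLPFeasible x) :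
    ∃ x', IsIntegerSelection x x' := by
  choose q hq using fun g => exists_pos_of_sum_eq_one (hx.plan g)
  choose p hp using fun j => exists_pos_of_sum_eq_one (hx.route j)
  exact ⟨Sol.ofSelection q p, fun g => ⟨q g, hq g, rfl⟩, fun j => ⟨p j, hp j, rfl⟩⟩

/-- The invariant is needed only for `integer`: the stored solution is feasible for the relaxation,
so each fire and each crew has a column in its support. -/
theorem Invariant.exists_step {M M' : ℝ} {s : S.State} (hs : Invariant M M' s)
    (hr : s.phase ≠ .returned) : ∃ s', Step M M' s s' := by
  obtain ⟨N, inc, ph⟩ := s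
  have h3 := hs.phase
  cases ph with
  | columnGeneration w =>
    obtain ⟨q, hq⟩ := exists_solvesFirePricing w
    obtain ⟨p, hp⟩ := exists_solvesCrewPricing w
    by_cases h : NonnegReducedCosts w q p
    · exact ⟨_, .pricingStop N inc w q p hq hp h⟩
    · obtain ⟨w', hw⟩ := exists_solvesMaster M' { w with cols := expand w q p }
      exact ⟨_, .pricingExpand N inc w w' q p hq hp h hw⟩
  | separation w => exact ⟨_, .noCuts N inc w⟩
  | evaluation w =>
    rcases le_or_gt (S.costOrTop inc) (S.costOrTop w.sol) with hc | hc
    · exact ⟨_, .prune N inc w hc⟩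
    · obtain ⟨x, hx⟩ : ∃ x, w.sol = some x := by
        cases e : w.sol with
        | none => rw [e] at hc; exact absurd hc not_top_lt
        | some x => exact ⟨x, rfl⟩
      by_cases h0 : ZeroVariance x
      · obtain ⟨x', hx'⟩ := (h3.2.optimal x hx).1.lp.exists_isIntegerSelection
        exact ⟨_, .integer N inc w x x' hx hc h0 hx'⟩
      · obtain ⟨a, ha⟩ := exists_maxVarianceBranching h0
        exact ⟨_, .branch N inc w x _ a hx hc h0 (fun _ _ => one_pos) ha⟩
  | heuristic => exact ⟨_, .heuristicSkip N inc⟩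
  | selection =>
    induction N using Multiset.induction_on with
    | empty => exact ⟨_, .finish inc⟩
    | cons i N _ => exact ⟨_, .select N inc i⟩
  | returned => exact absurd rfl hr

/-! ### Termination -/

/-- The number of columns that comply with the given branching decisions. -/
def numAllowed (b : List S.Branch) : ℕ :=
  (∑ g, (S.allowedPlans b g).card) + ∑ j, (S.allowedRoutes b j).card

theorem numAllowed_cons_lt {a : S.Branch} {b : List S.Branch}
    (h : (∃ g, ∃ q ∈ S.allowedPlans b g, ¬ a.AllowsPlan g q) ∨
      ∃ j, ∃ p ∈ S.allowedRoutes b j, ¬ a.AllowsRoute j p) :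
    numAllowed (a :: b) < numAllowed b := by
  unfold numAllowed
  simp only [allowedPlans_cons, allowedRoutes_cons]
  have h1 : ∀ g ∈ Finset.univ, ((S.allowedPlans b g).filter fun q => a.AllowsPlan g q).card ≤
      (S.allowedPlans b g).card := fun g _ => Finset.card_filter_le _ _
  have h2 : ∀ j ∈ Finset.univ, ((S.allowedRoutes b j).filter fun q => a.AllowsRoute j q).card ≤
      (S.allowedRoutes b j).card := fun g _ => Finset.card_filter_le _ _
  rcases h with ⟨g, q, hq, hn⟩ | ⟨j, p, hp, hn⟩
  · exact add_lt_add_of_lt_of_le (Finset.sum_lt_sum h1 ⟨g, Finset.mem_univ _,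
      Finset.card_lt_card (Finset.filter_ssubset.2 ⟨q, hq, hn⟩)⟩) (Finset.sum_le_sum h2)
  · exact add_lt_add_of_le_of_lt (Finset.sum_le_sum h1) (Finset.sum_lt_sum h2 ⟨j, Finset.mem_univ _,
      Finset.card_lt_card (Finset.filter_ssubset.2 ⟨p, hp, hn⟩)⟩)

/-- Both sides of a branching disjunction exclude some column. -/
theorem MaxVarianceBranching.numAllowed_lt (hS : S.Regular) {ω : S.Fire → S.Time → ℝ} {x : S.Sol}
    {a : Bool → S.Branch} (ha : MaxVarianceBranching ω x a) (hx : S.IsLPFeasible x)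
    (h : ¬ ZeroVariance x) (hω : ∀ g t, 0 < ω g t) {b : List S.Branch} (hb : Complies b x)
    (up : Bool) : numAllowed (a up :: b) < numAllowed b := by
  refine numAllowed_cons_lt ?_
  cases ha with
  | fire g t hmax =>
    left
    have hpos := pos_of_isMaxVariance hx h hω hmax
    rw [fireVar_eq] at hpos
    have hne : fireVar (fun _ _ => 1) x g t ≠ 0 := fun e => by simp [e] at hpos
    simp only [fireVar, mul_one] at hne
    have hmean : 0 ≤ meanDemand x g t :=
      Finset.sum_nonneg fun q _ => mul_nonneg (Nat.cast_nonneg _) (hx.y_nonneg g q)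
    cases up with
    | true =>
      obtain ⟨q, hq, hlt⟩ := exists_lt_mean_of_variance_ne_zero (hx.y_nonneg g) (hx.plan g) hne
      refine ⟨g, q, hb.1 g q hq, fun hall => ?_⟩
      have := (hall rfl).2 rfl
      -- A natural number exceeds the rounded-down mean exactly when it exceeds the mean. So the
      -- plan below the mean is excluded here, and the one above it on the other side.
      rw [Nat.floor_lt hmean] at this
      exact absurd this (not_lt.2 hlt.le)
    | false =>
      obtain ⟨q, hq, hlt⟩ := exists_mean_lt_of_variance_ne_zero (hx.y_nonneg g) (hx.plan g) hne
      refine ⟨g, q, hb.1 g q hq, fun hall => ?_⟩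
      exact absurd ((hall rfl).1 ((Nat.floor_lt hmean).2 hlt)) Bool.false_ne_true
  | crew j g t hmax =>
    right
    have hpos := pos_of_isMaxVariance hx h hω hmax
    rw [crewVar_eq] at hpos
    have hne : crewVar (fun _ _ => 1) x j g t ≠ 0 := fun e => by simp [e] at hpos
    simp only [crewVar, mul_one] at hne
    have hA : ∀ p, (S.A j p g t : ℝ) ≤ 1 := fun p => by exact_mod_cast hS.A_le_one j p g t
    cases up with
    | true =>
      obtain ⟨p, hp, hlt⟩ := exists_lt_mean_of_variance_ne_zero (hx.z_nonneg j) (hx.route j) hne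
      refine ⟨j, p, hb.2 j p hp, fun hall => ?_⟩
      have h1 : S.A j p g t = 1 := (hall rfl).2 rfl
      rw [h1] at hlt
      have : ∑ c, (S.A j c g t : ℝ) * x.z j c ≤ ∑ c, x.z j c := Finset.sum_le_sum fun c _ =>
        mul_le_of_le_one_left (hx.z_nonneg j c) (hA c)
      rw [hx.route j] at this
      push_cast at hlt
      linarith
    | false =>
      obtain ⟨p, hp, hlt⟩ := exists_mean_lt_of_variance_ne_zero (hx.z_nonneg j) (hx.route j) hne
      refine ⟨j, p, hb.2 j p hp, fun hall => ?_⟩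
      have : 0 ≤ ∑ c, (S.A j c g t : ℝ) * x.z j c := Finset.sum_nonneg fun c _ =>
        mul_nonneg (Nat.cast_nonneg _) (hx.z_nonneg j c)
      have h0 : 0 < S.A j p g t := Nat.cast_pos.1 (this.trans_lt hlt)
      have h1 : S.A j p g t = 1 := le_antisymm (hS.A_le_one j p g t) h0
      exact absurd ((hall rfl).1 h1) Bool.false_ne_true

/-! ### Rank functions for termination. -/

/-- The weight of the part of the branching tree that is still to be explored. -/
def State.weight (s : S.State) : ℕ :=
  (s.unexplored.map fun i => 3 * 4 ^ numAllowed i.branch).sum +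
    s.phase.branch?.elim 0 fun b => 2 * 4 ^ numAllowed b

/-- The number of valid cuts that have not been added. -/
def cutsLeft (U : Finset S.Cut) : ℕ := (S.finite_validCuts.toFinset \ U).card

/-- The number of columns that have not been generated. -/
def colsLeft (C : S.Columns) : ℕ := (∑ g, (C.Q g)ᶜ.card) + ∑ j, (C.P j)ᶜ.card

/-- The number of columns. -/
def numCols (S : SetPartitioning.{u}) : ℕ :=
  (∑ g, Fintype.card (S.Plan g)) + ∑ j, Fintype.card (S.Route j)

theorem colsLeft_le (C : S.Columns) : colsLeft C ≤ S.numCols :=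
  add_le_add (Finset.sum_le_sum fun _ _ => Finset.card_le_univ _)
    (Finset.sum_le_sum fun _ _ => Finset.card_le_univ _)

/-- Some generated column has negative reduced cost. -/
def HasNegativeColumn (w : S.Work) : Prop :=
  (∃ g, ∃ q ∈ w.cols.Q g, planReducedCost w.cuts w.dual g q < 0) ∨
    ∃ j, ∃ p ∈ w.cols.P j, routeReducedCost w.cuts w.dual j p < 0

/-- The progress of column generation. -/
def genRank (w : S.Work) : ℕ := 2 * colsLeft w.cols + if HasNegativeColumn w then 1 else 0

/-- The progress within a node, or between two nodes. -/
def Phase.rank : S.Phase → ℕ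
  | .columnGeneration w => cutsLeft w.cuts * (2 * S.numCols + 4) + genRank w + 2
  | .separation w => cutsLeft w.cuts * (2 * S.numCols + 4) + 1
  | .evaluation _ => 0
  | .heuristic => 2
  | .selection => 1
  | .returned => 0

/-- In the optimal case this is dual feasibility. In the infeasible case generated columns have
value at most zero under the ray, and nonnegative costs together with `M' ≥ 0` do the rest. -/
theorem not_hasNegativeColumn_of_solvesMaster (hS : S.Regular) {M' : ℝ} (hM : 0 ≤ M') {w w' : S.Work}
    (h : SolvesMaster M' w w') : ¬ HasNegativeColumn w' := by
  cases h with
  | optimal x D hx hD =>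
    rintro (⟨g, q, hq, hlt⟩ | ⟨j, p, hp, hlt⟩)
    · exact absurd (sub_nonneg.2 (hD.1.plan g q hq)) (not_le.2 hlt)
    · exact absurd (sub_nonneg.2 (hD.1.route j p hp)) (not_le.2 hlt)
  | infeasible D hx hD =>
    obtain ⟨-, h1, h2⟩ := (extremePoints_subset hD.1).1
    rintro (⟨g, q, hq, hlt⟩ | ⟨j, p, hp, hlt⟩)
    · simp only [planReducedCost, planValue_smul] at hlt
      have := mul_nonpos_of_nonneg_of_nonpos hM (h1 g q hq)
      have := hS.planCost_nonneg g q
      linarith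
    · simp only [routeReducedCost, routeValue_smul] at hlt
      have := mul_nonpos_of_nonneg_of_nonpos hM (h2 j p hp)
      have := hS.routeCost_nonneg j p
      linarith

theorem colsLeft_le_of_subset {C C' : S.Columns} (hQ : ∀ g, C.Q g ⊆ C'.Q g)
    (hP : ∀ j, C.P j ⊆ C'.P j) : colsLeft C' ≤ colsLeft C :=
  add_le_add (Finset.sum_le_sum fun g _ => Finset.card_le_card (Finset.compl_subset_compl.2 (hQ g)))
    (Finset.sum_le_sum fun j _ => Finset.card_le_card (Finset.compl_subset_compl.2 (hP j)))

theorem colsLeft_lt_of_subset {C C' : S.Columns} (hQ : ∀ g, C.Q g ⊆ C'.Q g)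
    (hP : ∀ j, C.P j ⊆ C'.P j) (h : (∃ g, ∃ q ∈ C'.Q g, q ∉ C.Q g) ∨ ∃ j, ∃ p ∈ C'.P j, p ∉ C.P j) :
    colsLeft C' < colsLeft C := by
  have h1 : ∀ g ∈ Finset.univ, (C'.Q g)ᶜ.card ≤ (C.Q g)ᶜ.card := fun g _ =>
    Finset.card_le_card (Finset.compl_subset_compl.2 (hQ g))
  have h2 : ∀ j ∈ Finset.univ, (C'.P j)ᶜ.card ≤ (C.P j)ᶜ.card := fun g _ =>
    Finset.card_le_card (Finset.compl_subset_compl.2 (hP g))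
  rcases h with ⟨g, q, hq, hn⟩ | ⟨j, p, hp, hn⟩
  · exact add_lt_add_of_lt_of_le (Finset.sum_lt_sum h1 ⟨g, Finset.mem_univ _, Finset.card_lt_card
      (Finset.compl_ssubset_compl.2 ⟨hQ g, fun hs => hn (hs hq)⟩)⟩) (Finset.sum_le_sum h2)
  · exact add_lt_add_of_le_of_lt (Finset.sum_le_sum h1) (Finset.sum_lt_sum h2 ⟨j, Finset.mem_univ _,
      Finset.card_lt_card (Finset.compl_ssubset_compl.2 ⟨hP j, fun hs => hn (hs hp)⟩)⟩)

/-- At the initial prices a column already present may price out negative, so the first round may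
add nothing new; the flag in `genRank` pays for it. After a master has been solved, a column of
negative reduced cost is necessarily new. -/
theorem genRank_lt (hS : S.Regular) {M' : ℝ} (hM : 0 ≤ M') {w w' : S.Work}
    {q : ∀ g, Option (S.Plan g)} {p : ∀ j, Option (S.Route j)} (h : ¬ NonnegReducedCosts w q p)
    (hw : SolvesMaster M' { w with cols := expand w q p } w') : genRank w' < genRank w := by
  have hQ : ∀ g, w.cols.Q g ⊆ (expand w q p).Q g := fun g => Finset.subset_union_left
  have hP : ∀ j, w.cols.P j ⊆ (expand w q p).P j := fun j => Finset.subset_union_left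
  have h1 := not_hasNegativeColumn_of_solvesMaster hS hM hw
  have h2 := colsLeft_le_of_subset hQ hP
  unfold genRank
  rw [if_neg h1, hw.cols_eq]
  by_cases h0 : HasNegativeColumn w
  · rw [if_pos h0]
    simp only
    omega
  · rw [if_neg h0]
    have h3 : colsLeft (expand w q p) < colsLeft w.cols := by
      refine colsLeft_lt_of_subset hQ hP ?_
      rw [NonnegReducedCosts, not_and_or] at h
      push Not at h
      rcases h with ⟨g, r, hr, hlt⟩ | ⟨j, r, hr, hlt⟩
      · refine Or.inl ⟨g, r, Finset.mem_union_right _ (Finset.mem_filter.2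
          ⟨Option.mem_toFinset.2 hr, hlt⟩), fun hmem => h0 (Or.inl ⟨g, r, hmem, hlt⟩)⟩
      · refine Or.inr ⟨j, r, Finset.mem_union_right _ (Finset.mem_filter.2
          ⟨Option.mem_toFinset.2 hr, hlt⟩), fun hmem => h0 (Or.inr ⟨j, r, hmem, hlt⟩)⟩
    simp only
    omega

theorem genRank_le (w : S.Work) : genRank w ≤ 2 * S.numCols + 1 := by
  have := colsLeft_le w.cols
  unfold genRank
  split_ifs <;> omega

/-- The current solution satisfies all cuts already present, so a violated cut is new. -/
theorem cutsLeft_union_lt {w : S.Work} {x : S.Sol} {V : Finset S.Cut}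
    (hx : ∀ u ∈ w.cuts, u.lhs x ≤ u.rhs) (hV : V.Nonempty)
    (h : ∀ u ∈ V, (S.IsGUBCover u ∨ S.IsAugmentedGUB u) ∧ u.rhs < u.lhs x) :
    cutsLeft (w.cuts ∪ V) < cutsLeft w.cuts := by
  obtain ⟨u, hu⟩ := hV
  refine Finset.card_lt_card ⟨Finset.sdiff_subset_sdiff subset_rfl Finset.subset_union_left,
    fun hs => ?_⟩
  have hmem : u ∈ S.finite_validCuts.toFinset \ w.cuts := Finset.mem_sdiff.2
    ⟨S.finite_validCuts.mem_toFinset.2 (h u hu).1,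
      fun hmem => absurd (hx u hmem) (not_le.2 (h u hu).2)⟩
  exact (Finset.mem_sdiff.1 (hs hmem)).2 (Finset.mem_union_right _ hu)

/-- The lexicographic rank of a state. -/
def State.rank (s : S.State) : ℕ ×ₗ ℕ := toLex (s.weight, s.phase.rank)

/-- The weight drops when a node is selected, closed or branched on; all other steps keep it and
lower the rank of the phase. -/
theorem rank_lt_of_step (hS : S.Regular) {M M' : ℝ} (hM : 0 ≤ M') {s s' : S.State}
    (hs : Invariant M M' s) (h : Step M M' s s') : s'.rank < s.rank := by
  have hsame : s'.weight = s.weight → s'.phase.rank < s.phase.rank → s'.rank < s.rank :=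
    fun h1 h2 => by
      rw [State.rank, State.rank, h1]
      exact Prod.Lex.right _ h2
  have hdrop : s'.weight < s.weight → s'.rank < s.rank := fun h1 => Prod.Lex.left _ _ h1
  have h3 := hs.phase
  cases h with
  | pricingStop N inc w q p hq hp h =>
    exact hsame rfl (by simp only [Phase.rank]; omega)
  | pricingExpand N inc w w' q p hq hp h hw =>
    refine hsame ?_ ?_
    · simp only [State.weight, Phase.branch?, hw.branch_eq]
    · have := genRank_lt hS hM h hw
      simp only [Phase.rank, hw.cuts_eq]
      omega
  | addCuts N inc w x V hx hV h =>
    refine hsame rfl ?_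
    have h4 := cutsLeft_union_lt (w := w) (h3.2.optimal x hx).1.cuts hV h
    -- Restarting column generation costs at most `(2 * numCols + 1) + 2`, which is less than the `2
    -- * numCols + 4` gained from one cut fewer.
    have h5 := genRank_le (S.initWork M M' w.branch w.cols (w.cuts ∪ V))
    have h6 := Nat.mul_le_mul_right (2 * S.numCols + 4) (Nat.succ_le_of_lt h4)
    rw [Nat.succ_mul] at h6
    simp only [Phase.rank, initWork] at h5 ⊢
    omega
  | noCuts N inc w => exact hsame rfl (by simp only [Phase.rank]; omega)
  | integer N inc w x x' hx hc h hx' =>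
    refine hdrop ?_
    simp only [State.weight, Phase.branch?, Option.elim]
    have : 0 < 4 ^ numAllowed w.branch := by positivity
    omega
  | prune N inc w hc =>
    refine hdrop ?_
    simp only [State.weight, Phase.branch?, Option.elim]
    have : 0 < 4 ^ numAllowed w.branch := by positivity
    omega
  | branch N inc w x ω a hx hc h hω ha =>
    refine hdrop ?_
    have hopt := (h3.2.optimal x hx).1
    have hcomp : Complies w.branch x :=
      ⟨fun g q hq => h3.1.plans g (by by_contra hn; exact hq (hopt.y_supp g q hn)),
        fun j p hp => h3.1.routes j (by by_contra hn; exact hp (hopt.z_supp j p hn))⟩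
    -- With `n` columns allowed at the parent, each child weighs at most `3 * 4 ^ (n - 1)`. Two
    -- children weigh `6 * 4 ^ (n - 1)`, less than the parent's `2 * 4 ^ n`. The factor 3 against 2
    -- makes selection a descent.
    have hlt : ∀ up, 4 ^ numAllowed (a up :: w.branch) * 4 ≤ 4 ^ numAllowed w.branch := fun up => by
      rw [← pow_succ]
      exact Nat.pow_le_pow_right (by norm_num) (ha.numAllowed_lt hS hopt.lp h hω hcomp up)
    have h1 := hlt true
    have h2 := hlt false
    have : 0 < 4 ^ numAllowed w.branch := by positivity
    simp only [State.weight, Phase.branch?, Option.elim, Multiset.map_cons, Multiset.sum_cons, child]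
    omega
  | heuristicSkip N inc => exact hsame rfl (by simp only [Phase.rank]; omega)
  | heuristicImprove N inc x hx hc => exact hsame rfl (by simp only [Phase.rank]; omega)
  | select N inc i =>
    refine hdrop ?_
    simp only [State.weight, Phase.branch?, Option.elim, Multiset.map_cons, Multiset.sum_cons,
      initWork]
    have : 0 < 4 ^ numAllowed i.branch := by positivity
    omega
  | finish inc => exact hsame rfl (by simp only [Phase.rank]; omega)

theorem not_exists_infinite_run (hS : S.Regular) [Nonempty S.Fire] {M M' : ℝ}
    (hM : S.IsThreshold M M') :
    ¬ ∃ s : ℕ → S.State, s 0 = S.initState M M' ∧ ∀ n, Step M M' (s n) (s (n + 1)) := by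
  rintro ⟨s, h0, h⟩
  have hinv : ∀ n, Invariant M M' (s n) := fun n => by
    induction n with
    | zero => rw [h0]; exact invariant_initState M M'
    | succ n ih => exact invariant_step hS hM ih (h n)
  have hanti : StrictAnti fun n => (s n).rank :=
    strictAnti_nat_of_succ_lt fun n => rank_lt_of_step hS hM.nonneg (hinv n) (h n)
  exact not_strictAnti_of_wellFoundedLT _ hanti

end SetPartitioning

/-! ### The wildfire problem -/

namespace NetPath

/-- Times increase strictly along the chain, so the first arc leaves earlier than all later ones;
induction handles the tail. -/
theorem eq_of_mem_zip_tail {V : Type u} {r : V → V → Prop} (time : V → ℕ)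
    (ht : ∀ a b, r a b → time a < time b) {l : List V} (hl : l.IsChain r) {a b : V × V}
    (ha : a ∈ l.zip l.tail) (hb : b ∈ l.zip l.tail) (hab : time a.1 = time b.1) : a = b := by
  induction l with
  | nil => simp at ha
  | cons v l ih =>
    cases l with
    | nil => simp at ha
    | cons w l =>
      have hlt : ∀ c ∈ (w :: l).zip l, time v < time c.1 := by
        have : IsTrans V (fun a b => time a < time b) := ⟨fun _ _ _ h k => lt_trans h k⟩
        have hp := (hl.imp (fun a b h => ht a b h) : List.IsChain (fun a b => time a < time b) _).pairwise
        rintro ⟨c, c'⟩ hc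
        exact (List.pairwise_cons.1 hp).1 c (List.of_mem_zip hc).1
      simp only [List.tail_cons, List.zip_cons_cons, List.mem_cons] at ha hb ih
      rcases ha with rfl | ha <;> rcases hb with rfl | hb
      · rfl
      · exact absurd hab (hlt b hb).ne
      · exact absurd hab (hlt a ha).ne'
      · exact ih (List.isChain_cons_cons.1 hl).2 ha hb

/-- A path whose arcs go forward in time has at most one arc that leaves at a given time. -/
theorem eq_of_mem_arcs {V : Type u} {arc : V → V → Prop} {start : V} {final : V → Prop}
    (time : V → ℕ) (ht : ∀ a b, arc a b → time a < time b) (p : NetPath arc start final)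
    {a b : V × V} (ha : a ∈ p.arcs) (hb : b ∈ p.arcs) (hab : time a.1 = time b.1) : a = b :=
  eq_of_mem_zip_tail time ht p.chain (List.mem_toFinset.1 ha) (List.mem_toFinset.1 hb) hab

end NetPath

namespace WildfireInstance

variable (W : WildfireInstance.{u})

theorem time_lt_of_crewArc (j : W.Crew) (a b : W.CrewNode) (h : W.CrewArc j a b) :
    a.2.1 < b.2.1 := by
  rcases h with ⟨-, -, h | h | h⟩
  · obtain ⟨-, -, -, k, hk, e⟩ := h
    have := (Finset.mem_Icc.1 hk.1.1).1
    omega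
  · have := h.2.2.2.2
    omega
  · obtain ⟨-, -, h | h⟩ := h
    · exact h.2.2.1
    · have := h.2
      omega

/-- If no number of crews realizes the transition, the infimum of the empty set is 0, so the bound
does not require `a` to be an arc. -/
theorem arcCrews_le (g : W.Fire) (a : W.FireNode g × W.FireNode g) :
    W.arcCrews g a ≤ Fintype.card W.Crew := by
  unfold arcCrews
  rcases (W.crewNumbers g a.1.2 a.1.1 a.2.1).eq_empty_or_nonempty with h | h
  · simp [h]
  · exact (Nat.sInf_mem h).1

/-- A path has at most one arc leaving in a given period. A route is thus at one location, and
distinct fires have distinct locations; the demand of a plan is a sum with at most one term. -/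
theorem problem_regular (hd : ∀ g q, 0 ≤ W.problem.planCost g q)
    (hc : ∀ j p, 0 ≤ W.problem.routeCost j p) : W.problem.Regular where
  planCost_nonneg := hd
  routeCost_nonneg := hc
  sum_A_le_one j p t := by
    have hA : ∀ g, W.problem.A j p g t =
        if ((NetPath.arcs p : Set _) ∩ W.workArcs j g t).Nonempty then 1 else 0 := fun g => rfl
    simp only [hA, Finset.sum_boole]
    refine Finset.card_le_one.2 fun g hg g' hg' => ?_
    obtain ⟨a, ha, -, -, hl, ht⟩ := (Finset.mem_filter.1 hg).2
    obtain ⟨b, hb, -, -, hl', ht'⟩ := (Finset.mem_filter.1 hg').2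
    have hab : a = b := NetPath.eq_of_mem_arcs (fun n => n.2.1) (W.time_lt_of_crewArc j) p ha hb
      (ht.trans ht'.symm)
    rw [hab] at hl
    exact W.fireLoc.injective (hl.symm.trans hl')
  B_le_numCrews g q t := by
    show ∑ a ∈ (NetPath.arcs q).filter (fun a => 0 < W.arcCrews g a ∧ a.1.2 = t), W.arcCrews g a ≤
      Fintype.card W.Crew
    rcases ((NetPath.arcs q).filter
      (fun a => 0 < W.arcCrews g a ∧ a.1.2 = t)).eq_empty_or_nonempty with h | ⟨a, ha⟩
    · rw [h]; exact Nat.zero_le _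
    · rw [Finset.sum_eq_single a (fun b hb hne => ?_) (fun h => absurd ha h)]
      · exact W.arcCrews_le g a
      · rw [Finset.mem_filter] at ha hb
        exact absurd (NetPath.eq_of_mem_arcs (fun n => n.2)
          (fun a b h => by have := h.2.2.1; omega) q hb.1 ha.1 (hb.2.2.trans ha.2.2.symm)) hne

end WildfireInstance
end Wildfire
end

/-! ### The main theorem. -/

theorem mainTheorem1 (W : Wildfire.WildfireInstance.{u}) [Nonempty W.Fire]
    (hd : ∀ g q, 0 ≤ W.problem.planCost g q) (hc : ∀ j p, 0 ≤ W.problem.routeCost j p)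
    (M : ℝ) (hM : 0 ≤ M) :
    ∃ M₀ : ℝ, ∀ M' : ℝ, M₀ ≤ M' →
      -- every run is finite
      (¬ ∃ s : ℕ → W.problem.State, s 0 = W.problem.initState M M' ∧
        ∀ n, Wildfire.SetPartitioning.Step M M' (s n) (s (n + 1))) ∧
      -- no run gets stuck before the algorithm returns
      (∀ s : W.problem.State, Wildfire.SetPartitioning.Reachable M M' s → s.phase ≠ .returned →
        ∃ s', Wildfire.SetPartitioning.Step M M' s s') ∧
      -- what the algorithm returns is an optimal solution, unless the problem is infeasible
      ∀ s : W.problem.State, Wildfire.SetPartitioning.Reachable M M' s → s.phase = .returned →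
        (∀ x, s.incumbent = some x → W.problem.IsOptimal x) ∧
        (s.incumbent = none → ∀ x, ¬ W.problem.IsFeasible x) := by
  have hS := W.problem_regular hd hc
  have : Nonempty W.problem.Fire := ‹Nonempty W.Fire›
  -- The threshold collects finitely many strict lower bounds on `M'`: one for each plan at the
  -- initial prices, and one for each ray and each column of positive value under it.
  obtain ⟨M₀, h⟩ := Filter.eventually_atTop.1 (W.problem.eventually_isThreshold M)
  refine ⟨M₀, fun M' hM' => ⟨Wildfire.SetPartitioning.not_exists_infinite_run hS (h M' hM'),
    fun s hs hr => ?_, fun s hs hr => ?_⟩⟩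
  · exact (Wildfire.SetPartitioning.invariant_of_reachable hS (h M' hM') hs).exists_step hr
  · exact (Wildfire.SetPartitioning.invariant_of_reachable hS (h M' hM') hs).isOptimal hr
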